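/- Normalisation identities for the full-turn matrices $\mathcal M_{p+k,k}$. Let $p\ge 1$ be an integer. All matrices are $p\times p$ with rational entries, with rows and columns numbered $1,\dots,p$. Let $\lfloor x\rfloor$ be the integer part of $x$ and $\mathrm{fr}(x)=x-\lfloor x\rfloor$. For $k\in\frac12\mathbb Z$ and $\epsilon=-1$ let $\mathcal M_k$ be the simple-crossing matrix with $\mathcal M_k[i,i]=1$, $$\mathcal M_k[i,j]=-\epsilon^{\lfloor\frac{j-k}p\rfloor-\lfloor\frac{i-k}p\rfloor}\,\frac{p!}{|i-j|!\,(p-|i-j|)!}\quad\text{if } i\ne j,\ \ i+j\equiv 2k \bmod p,\ \ \mathrm{fr}\big(\tfrac{i-k}p\big)>\mathrm{fr}\big(\tfrac{j-k}p\big),$$ and $\mathcal M_k[i,j]=0$ otherwise. (These matrices describe the crossings of singular axes between the unit roots for the monomial input $F(x)=(1-px)^p$.) For $k_1,k_2\in\frac12\mathbb Z$ with $k_2>k_1$ put $$\mathcal M_{k_2,k_1}=\mathcal M_{k_2}\,\mathcal M_{k_2-\frac12}\,\mathcal M_{k_2-1}\cdots\mathcal M_{k_1+1}\,\mathcal M_{k_1+\frac12},$$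 and $\mathcal M_{k,k}=\mathcal I$, $\mathcal M_{k_2,k_1}=\mathcal M_{k_1,k_2}^{-1}$ if $k_2<k_1$. Let $\mathcal I$ be the identity and let $\mathcal J[i,j]=1$ if $j=i+1$, $\mathcal J[i,j]=0$ otherwise. For $\delta\in\mathbb Z$ and $d\ge0$ let $H^\delta_d(x,y)$ be the polynomials determined by $H^\delta_d(x,y)=H^\delta_d(x,y-1)+(x-d)H^\delta_{d-1}(x,y-1)$, with $H^\delta_{-1}=0$ and $H^\delta_d(x,0)=\prod_{0<m\le d}(x+\delta+m)$; explicitly $$H^\delta_d(x,y)=\sum_{m=0}^d\frac1{m!}\prod_{0\le a<m}(x-d+a)\prod_{1\le b\le d-m}(x+\delta+b)\prod_{0\le c<m}(y-c).$$ Let $r\in\{0,1,2,3\}$ be the residue of $p$ modulo $4$ and write $$A_{ij}=\frac{(i-1)!}{(j-1)!\,(i-j)!},\qquad B_{ij}=\frac{(p-j)!}{(p-i)!\,(i-j)!}.$$ Let $\mathcal L,\mathcal R$ be the lower-triangular matrices ($\mathcal L[i,j]=\mathcal R[i,j]=0$ for $i<j$) whose entries for $i\ge j$ are as follows. Matrix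 $\mathcal L$: - $r=0$: if $2j>p$, $(-1)^jB_{ij}$; if $2j\le p$ and $i+j\le p+2$, $(-1)^iA_{ij}$; if $2j\le p$ and $i+j>p+2$, $(-1)^j\frac{(i-1)!}{(2j-3)!\,(p-2j+2)!}H^1_{p-i}(j-2,p)$. - $r=1$: if $2j>p+1$, $(-1)^jB_{ij}$; if $2j\le p+1$ and $i+j\le p+2$, $(-1)^iA_{ij}$; if $2j\le p+1$ and $i+j>p+2$, $-(-1)^j\frac{(i-1)!}{(2j-3)!\,(p-2j+2)!}H^1_{p-i}(j-2,p)$. - $r=2$: if $2j>p$, $(-1)^jB_{ij}$; if $2j\le p$ and $i+j\le p+1$, $(-1)^iA_{ij}$; if $2j\le p$ and $i+j>p+1$, $-(-1)^j\frac{(i-1)!}{(2j-2)!\,(p-2j+1)!}H^0_{p-i}(j-1,p)$. - $r=3$: if $2j>p-1$, $(-1)^{p-j}B_{ij}$; if $2j\le p-1$ and $i+j\le p+1$, $(-1)^{i-1}A_{ij}$; if $2j\le p-1$ and $i+j>p+1$, $(-1)^{j-1}\frac{(i-1)!}{(2j-2)!\,(p-2j+1)!}H^0_{p-i}(j-1,p)$.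 Matrix $\mathcal R$: - $r=0$: if $2j>p-2$, $(-1)^jB_{ij}$; if $2j\le p-2$ and $i+j\le p$, $(-1)^iA_{ij}$; if $2j\le p-2$ and $i+j>p$, $(-1)^j\frac{(i-1)!}{(2j-1)!\,(p-2j)!}H^{-1}_{p-i}(j,p)$. - $r=1$: if $2j>p-1$, $(-1)^jB_{ij}$; if $2j\le p-1$ and $i+j\le p$, $(-1)^iA_{ij}$; if $2j\le p-1$ and $i+j>p$, $-(-1)^j\frac{(i-1)!}{(2j-1)!\,(p-2j)!}H^{-1}_{p-i}(j,p)$. - $r=2$: if $2j>p-2$, $(-1)^jB_{ij}$; if $2j\le p-2$ and $i+j\le p-1$, $(-1)^iA_{ij}$; if $2j\le p-2$ and $i+j>p-1$, $-(-1)^j\frac{(i-1)!}{(2j)!\,(p-2j-1)!}H^{-2}_{p-i}(j+1,p)$. - $r=3$: if $2j>p-3$, $(-1)^{p-j}B_{ij}$; if $2j\le p-3$ and $i+j\le p-1$, $(-1)^{i-1}A_{ij}$; if $2j\le p-3$ and $i+j>p-1$, $(-1)^{j-1}\frac{(i-1)!}{(2j)!\,(p-2j-1)!}H^{-2}_{p-i}(j+1,p)$.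 Then $\mathcal L$ and $\mathcal R$ are invertible, and at $\epsilon=-1$: 1. if $p\equiv 0$ or $1 \pmod 4$, then $\mathcal L\,\mathcal M_{p+1,1}\,\mathcal L^{-1}=\mathcal R\,\mathcal M_{p,0}\,\mathcal R^{-1}=(-1)^{p-1}(\mathcal I+\mathcal J)^p$; 2. if $p\equiv 2$ or $3 \pmod 4$, then $\mathcal L\,\mathcal M_{p+\frac12,\frac12}\,\mathcal L^{-1}=\mathcal R\,\mathcal M_{p-\frac12,-\frac12}\,\mathcal R^{-1}=(-1)^{p-1}(\mathcal I+\mathcal J)^p$; 3. for every $p$, $\det(t\,\mathcal I-\mathcal M_{p,0})=\big(t+(-1)^p\big)^p$ as polynomials in $t$. -/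

import Mathlib

/-! Matrices of size `p × p` are indexed by `Fin p`; the index `i : Fin p` stands for the row or
column number `i + 1`, running from `1` to `p`. -/

/-- The simple-crossing matrix `M_k` (for `k` a half-integer), with the parameter `ε` left free.
Here `Int.fract` and `Int.floor` are the fractional and the entire part. -/
noncomputable def simpleCrossing {K : Type*} [Field K] (p : ℕ) (ε : K) (k : ℚ) :
    Matrix (Fin p) (Fin p) K :=
  Matrix.of fun a b =>
    let i : ℚ := (a : ℕ) + 1
    let j : ℚ := (b : ℕ) + 1
    if a = b then 1
    else if Int.fract ((i + j - 2 * k) / p) = 0 ∧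
        Int.fract ((j - k) / p) < Int.fract ((i - k) / p) then
      -(ε ^ (⌊(j - k) / (p : ℚ)⌋ - ⌊(i - k) / (p : ℚ)⌋)
        * (p.choose ((a : ℤ) - (b : ℤ)).natAbs : K))
    else 0

/-- The multiple-crossing matrix `M_{k₂,k₁}` for half-integers `k₂ = κ₂ / 2` and `k₁ = κ₁ / 2`:
the ordered product `M_{k₂} M_{k₂ - 1/2} ⋯ M_{k₁ + 1/2}` when `k₁ ≤ k₂` (the identity when
`k₁ = k₂`), and the inverse of `M_{k₁,k₂}` when `k₂ < k₁`. -/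
noncomputable def multiCrossing {K : Type*} [Field K] (p : ℕ) (ε : K) (κ₂ κ₁ : ℤ) :
    Matrix (Fin p) (Fin p) K :=
  if κ₁ ≤ κ₂ then
    ((List.range (κ₂ - κ₁).toNat).map fun m : ℕ =>
      simpleCrossing p ε (((κ₂ : ℚ) - (m : ℚ)) / 2)).prod
  else
    (((List.range (κ₁ - κ₂).toNat).map fun m : ℕ =>
      simpleCrossing p ε (((κ₁ : ℚ) - (m : ℚ)) / 2)).prod)⁻¹

/-- The matrix `J` with ones on the first superdiagonal and zeros elsewhere. -/
def upperJordan (p : ℕ) : Matrix (Fin p) (Fin p) ℚ :=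
  Matrix.of fun a b => if (b : ℕ) = (a : ℕ) + 1 then 1 else 0

/-- The normal form `(-1)^(p-1) (I + J)^p`. -/
def jordanNormalForm (p : ℕ) : Matrix (Fin p) (Fin p) ℚ :=
  (-1 : ℚ) ^ (p - 1) • (1 + upperJordan p) ^ p

/-- The auxiliary polynomials `H^δ_d(x, y)`. They are determined by the difference equation
`H^δ_d(x, y) = H^δ_d(x, y - 1) + (x - d) H^δ_{d-1}(x, y - 1)` (with `H^δ_{-1} = 0`) and the initial
values `H^δ_d(x, 0) = ∏_{0 < m ≤ d} (x + δ + m)`; see `auxH_sub_one`, `auxH_zero_left` and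
`auxH_zero_right` below. -/
def auxH (δ : ℤ) (d : ℕ) (x y : ℚ) : ℚ :=
  ∑ m ∈ Finset.range (d + 1),
    (1 / (m.factorial : ℚ))
      * (∏ k ∈ Finset.range m, (x - d + k))
      * (∏ k ∈ Finset.Icc 1 (d - m), (x + δ + k))
      * (∏ k ∈ Finset.range m, (y - k))

theorem auxH_zero_left (δ : ℤ) (x y : ℚ) : auxH δ 0 x y = 1 := by
  simp [auxH]

theorem auxH_zero_right (δ : ℤ) (d : ℕ) (x : ℚ) :
    auxH δ d x 0 = ∏ k ∈ Finset.Icc 1 d, (x + δ + k) := by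
  unfold auxH
  rw [Finset.sum_range_succ']
  simp [Finset.prod_range_succ']

theorem auxH_sub_one (δ : ℤ) (d : ℕ) (x y : ℚ) :
    auxH δ (d + 1) x y = auxH δ (d + 1) x (y - 1) + (x - (d + 1)) * auxH δ d x (y - 1) := by
  have key : ∀ m : ℕ, (∏ k ∈ Finset.range (m + 1), (y - (k : ℚ)))
      = (∏ k ∈ Finset.range (m + 1), (y - 1 - (k : ℚ)))
        + (m + 1) * ∏ k ∈ Finset.range m, (y - 1 - (k : ℚ)) := by
    intro m
    rw [Finset.prod_range_succ', Finset.prod_range_succ]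
    have h : ∀ k ∈ Finset.range m, (y - ((k + 1 : ℕ) : ℚ)) = y - 1 - (k : ℚ) := by
      intro k _
      push_cast
      ring
    rw [Finset.prod_congr rfl h]
    push_cast
    ring
  unfold auxH
  rw [Finset.sum_range_succ', Finset.sum_range_succ' _ (d + 1), Finset.mul_sum, add_right_comm,
    ← Finset.sum_add_distrib]
  congr 1
  refine Finset.sum_congr rfl fun m _ => ?_
  rw [key, Finset.prod_range_succ' (fun k : ℕ => x - ((d + 1 : ℕ) : ℚ) + (k : ℚ)) m]
  have h : ∀ k ∈ Finset.range m,
      (x - ((d + 1 : ℕ) : ℚ) + ((k + 1 : ℕ) : ℚ)) = x - (d : ℚ) + (k : ℚ) := by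
    intro k _
    push_cast
    ring
  rw [Finset.prod_congr rfl h, Nat.add_sub_add_right, Nat.factorial_succ]
  have hm : (m.factorial : ℚ) ≠ 0 := by positivity
  have hm' : (m : ℚ) + 1 ≠ 0 := by positivity
  push_cast
  field_simp
  ring

open Nat in
/-- The entry in row `i` and column `j` (numbered from `1`) of the left normalising matrix `L`,
for `j ≤ i`. -/
def leftEntry (p i j : ℕ) : ℚ :=
  if p % 4 = 0 then
    if 2 * j ≤ p then
      if i + j ≤ p + 2 then (-1) ^ i * ((i - 1)! / ((j - 1)! * (i - j)!))
      else (-1) ^ j * ((i - 1)! / ((2 * j - 3)! * (p - 2 * j + 2)!)) * auxH 1 (p - i) (j - 2) p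
    else (-1) ^ j * ((p - j)! / ((p - i)! * (i - j)!))
  else if p % 4 = 1 then
    if 2 * j ≤ p + 1 then
      if i + j ≤ p + 2 then (-1) ^ i * ((i - 1)! / ((j - 1)! * (i - j)!))
      else -(-1) ^ j * ((i - 1)! / ((2 * j - 3)! * (p + 2 - 2 * j)!)) * auxH 1 (p - i) (j - 2) p
    else (-1) ^ j * ((p - j)! / ((p - i)! * (i - j)!))
  else if p % 4 = 2 then
    if 2 * j ≤ p then
      if i + j ≤ p + 1 then (-1) ^ i * ((i - 1)! / ((j - 1)! * (i - j)!))
      else -(-1) ^ j * ((i - 1)! / ((2 * j - 2)! * (p - 2 * j + 1)!)) * auxH 0 (p - i) (j - 1) p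
    else (-1) ^ j * ((p - j)! / ((p - i)! * (i - j)!))
  else
    if 2 * j + 1 ≤ p then
      if i + j ≤ p + 1 then (-1) ^ (i - 1) * ((i - 1)! / ((j - 1)! * (i - j)!))
      else (-1) ^ (j - 1) * ((i - 1)! / ((2 * j - 2)! * (p - 2 * j + 1)!))
        * auxH 0 (p - i) (j - 1) p
    else (-1) ^ (p - j) * ((p - j)! / ((p - i)! * (i - j)!))

open Nat in
/-- The entry in row `i` and column `j` (numbered from `1`) of the right normalising matrix `R`,
for `j ≤ i`. -/
def rightEntry (p i j : ℕ) : ℚ :=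
  if p % 4 = 0 then
    if 2 * j + 2 ≤ p then
      if i + j ≤ p then (-1) ^ i * ((i - 1)! / ((j - 1)! * (i - j)!))
      else (-1) ^ j * ((i - 1)! / ((2 * j - 1)! * (p - 2 * j)!)) * auxH (-1) (p - i) j p
    else (-1) ^ j * ((p - j)! / ((p - i)! * (i - j)!))
  else if p % 4 = 1 then
    if 2 * j + 1 ≤ p then
      if i + j ≤ p then (-1) ^ i * ((i - 1)! / ((j - 1)! * (i - j)!))
      else -(-1) ^ j * ((i - 1)! / ((2 * j - 1)! * (p - 2 * j)!)) * auxH (-1) (p - i) j p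
    else (-1) ^ j * ((p - j)! / ((p - i)! * (i - j)!))
  else if p % 4 = 2 then
    if 2 * j + 2 ≤ p then
      if i + j + 1 ≤ p then (-1) ^ i * ((i - 1)! / ((j - 1)! * (i - j)!))
      else -(-1) ^ j * ((i - 1)! / ((2 * j)! * (p - 2 * j - 1)!)) * auxH (-2) (p - i) (j + 1) p
    else (-1) ^ j * ((p - j)! / ((p - i)! * (i - j)!))
  else
    if 2 * j + 3 ≤ p then
      if i + j + 1 ≤ p then (-1) ^ (i - 1) * ((i - 1)! / ((j - 1)! * (i - j)!))
      else (-1) ^ (j - 1) * ((i - 1)! / ((2 * j)! * (p - 2 * j - 1)!))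
        * auxH (-2) (p - i) (j + 1) p
    else (-1) ^ (p - j) * ((p - j)! / ((p - i)! * (i - j)!))

/-- The left normalising matrix `L`. -/
def leftNormaliser (p : ℕ) : Matrix (Fin p) (Fin p) ℚ :=
  Matrix.of fun a b => if a < b then 0 else leftEntry p ((a : ℕ) + 1) ((b : ℕ) + 1)

/-- The right normalising matrix `R`. -/
def rightNormaliser (p : ℕ) : Matrix (Fin p) (Fin p) ℚ :=
  Matrix.of fun a b => if a < b then 0 else rightEntry p ((a : ℕ) + 1) ((b : ℕ) + 1)

/-! Let `S` be the twisted shift, sending each basis vector to the next and the last to minus the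
first, so that `S ^ p = -1`. At `ε = -1` the entries of `M_k` change sign when a row or column
number moves by `p`. Hence `S` conjugates `M_k` into `M_{k+1}` (`twistedShift_mul_simpleCrossing`).
Writing `M_{k+1} M_{k+1/2} = S T`, the full turn collapses to `S ^ p T ^ p = -T ^ p`
(`multiCrossing_add_two_mul`). It remains to find an invertible `D` with `D T = -(I + J) D`;
conjugation by `D` then gives `(-1)^(p-1) (I + J)^p`.

With `s = p + 2k` in `{p - 1, p, p + 1, p + 2}`, the matrix `T` is the superdiagonal minus binomials
on the antidiagonals `s` and `s + 1`, on and below the diagonal, together with a corner entry. The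
equation for `D` becomes `D[i,j] + D[i+1,j] + D[i,j-1] = ∑ k, D[i,k] C[k,j]`, where `C` is this
subtracted part (`normEntry_recurrence`). In the right half `D` consists of binomials, and so it
does above the antidiagonal in the left half, where the sum is zero away from the corner. Below the
antidiagonal the entries are values of `auxH`; the recurrence is then a contiguity relation between
`x` and `x - 1` (`auxH_contiguous`), whose inhomogeneous term produces the two binomials on the
right. The relation is proved by a telescoping certificate.

All this holds for every `p` and each of the four `s`. The residue of `p` modulo 4 only selects the
two values of `s` used for `L` and `R`, and a global sign. -/

/-! ### Rising and falling factorials. -/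

/-- The rising factorial `x (x + 1) ⋯ (x + n - 1)`. -/
def risingProd (x : ℚ) (n : ℕ) : ℚ := ∏ k ∈ Finset.range n, (x + k)

/-- The falling factorial `x (x - 1) ⋯ (x - n + 1)`. -/
def fallingProd (x : ℚ) (n : ℕ) : ℚ := ∏ k ∈ Finset.range n, (x - k)

theorem risingProd_zero (x : ℚ) : risingProd x 0 = 1 := by simp [risingProd]

theorem risingProd_succ (x : ℚ) (n : ℕ) : risingProd x (n + 1) = risingProd x n * (x + n) := by
  simp [risingProd, Finset.prod_range_succ]

theorem risingProd_succ_left (x : ℚ) (n : ℕ) :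
    risingProd x (n + 1) = x * risingProd (x + 1) n := by
  simp only [risingProd, Finset.prod_range_succ', Nat.cast_zero, add_zero]
  rw [mul_comm]
  congr 1
  refine Finset.prod_congr rfl fun k _ => ?_
  push_cast
  ring

theorem fallingProd_zero (x : ℚ) : fallingProd x 0 = 1 := by simp [fallingProd]

theorem fallingProd_succ (x : ℚ) (n : ℕ) :
    fallingProd x (n + 1) = fallingProd x n * (x - n) := by
  simp [fallingProd, Finset.prod_range_succ]

theorem fallingProd_succ_left (x : ℚ) (n : ℕ) :
    fallingProd x (n + 1) = x * fallingProd (x - 1) n := by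
  simp only [fallingProd, Finset.prod_range_succ', Nat.cast_zero, sub_zero]
  rw [mul_comm]
  congr 1
  refine Finset.prod_congr rfl fun k _ => ?_
  push_cast
  ring

theorem risingProd_sub_eq_fallingProd (x : ℚ) (n : ℕ) :
    risingProd (x - n) n = fallingProd (x - 1) n := by
  induction n generalizing x with
  | zero => simp [risingProd_zero, fallingProd_zero]
  | succ n ih =>
    rw [risingProd_succ_left, fallingProd_succ, ← ih]
    push_cast
    rw [show x - (n + 1) + 1 = x - n by ring]
    ring

theorem fallingProd_natCast (x n : ℕ) : fallingProd x n = n.factorial * (x.choose n : ℚ) := by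
  have h : ((x.descFactorial n : ℕ) : ℚ) = fallingProd x n := by
    induction n with
    | zero => simp [fallingProd_zero]
    | succ n ih =>
      rw [Nat.descFactorial_succ, fallingProd_succ, ← ih]
      rcases le_or_gt n x with h | h
      · push_cast [Nat.cast_sub h]
        ring
      · simp [Nat.descFactorial_of_lt h]
  rw [← h, Nat.descFactorial_eq_factorial_mul_choose]
  push_cast
  rfl

theorem auxH_eq_sum (δ : ℤ) (d : ℕ) (x y : ℚ) :
    auxH δ d x y = ∑ m ∈ Finset.range (d + 1),
      1 / (m.factorial : ℚ) * risingProd (x - d) m * risingProd (x + δ + 1) (d - m)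
        * fallingProd y m := by
  unfold auxH
  refine Finset.sum_congr rfl fun m _ => ?_
  have h : ∏ k ∈ Finset.Icc 1 (d - m), (x + δ + (k : ℚ)) = risingProd (x + δ + 1) (d - m) := by
    rw [risingProd, ← Finset.Ico_add_one_right_eq_Icc, Finset.prod_Ico_eq_prod_range,
      Nat.add_sub_cancel]
    refine Finset.prod_congr rfl fun k _ => ?_
    push_cast
    ring
  rw [h]
  rfl

/-! ### Contiguity relation and special values of the polynomials `auxH`. -/

/-- The telescoping certificate for the contiguity relation of `auxH`. -/
def auxHCertificate (q x y : ℚ) (d m : ℕ) : ℚ :=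
  m / m.factorial * fallingProd y m * risingProd (q + 1) (d - m)
    * ((y + 1 - (x + q)) * (y - x) * risingProd (x - d + 1) (m - 1)
      - q * (x + q) * risingProd (x - d) (m - 1))

/-- This is the creative-telescoping identity: each summand of the contiguity relation is a
difference of certificates. Here `q` stands for `x + δ`, and `d = m + b + 1` ensures `m < d`. The
factor `m` in the certificate makes the truncated `m - 1` harmless at `m = 0`. -/
theorem auxHCertificate_sub (q x y : ℚ) (m b : ℕ) :
    auxHCertificate q x y (m + b + 1) (m + 1) - auxHCertificate q x y (m + b + 1) m
      = 1 / (m.factorial : ℚ) * fallingProd y m *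
        ((y + 1 - (x + q)) * (y - (x + q)) *
          (risingProd (x - (m + b + 1 : ℕ)) m * risingProd (q + 1) (b + 1)
            + (y - (m + b + 1 : ℕ)) * risingProd (x - (m + b + 1 : ℕ) + 1) m
              * risingProd (q + 1) b)
        - (x + q) * (x + q - 1) *
          (risingProd (x - (m + b + 1 : ℕ) - 1) m * risingProd q (b + 1))) := by
  unfold auxHCertificate
  rw [show m + b + 1 - (m + 1) = b by omega, show m + b + 1 - m = b + 1 by omega,
    Nat.add_sub_cancel, Nat.factorial_succ, risingProd_succ_left q b,
    risingProd_succ (q + 1) b, fallingProd_succ]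
  have h1 : ((m : ℚ) + 1) ≠ 0 := by positivity
  have h2 : (m.factorial : ℚ) ≠ 0 := by positivity
  have h3 : ((m + 1 : ℕ) : ℚ) / ((m + 1) * m.factorial : ℕ) = 1 / (m.factorial : ℚ) := by
    push_cast
    field_simp
  rw [h3, div_eq_mul_one_div (m : ℚ)]
  set c := 1 / (m.factorial : ℚ)
  set Y := fallingProd y m
  set Q := risingProd (q + 1) b
  rcases m with _ | m
  · simp [risingProd_zero]
    ring
  · have e1 := risingProd_succ_left (x - (m + 1 + b + 1 : ℕ)) m
    have e2 := risingProd_succ_left (x - (m + 1 + b + 1 : ℕ) - 1) m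
    have e3 := risingProd_succ (x - (m + 1 + b + 1 : ℕ)) m
    have e4 := risingProd_succ (x - (m + 1 + b + 1 : ℕ) + 1) m
    rw [sub_add_cancel] at e2
    rw [Nat.add_sub_cancel, e2, e4, e1]
    -- The two factorisations of the rising product of length `m + 1` give the one relation between
    -- `z` and `w` that is needed.
    rw [e1] at e3
    set z := risingProd (x - (m + 1 + b + 1 : ℕ)) m
    set w := risingProd (x - (m + 1 + b + 1 : ℕ) + 1) m
    push_cast at *
    linear_combination (-(c * Y * Q * q * (x + q) * (x + q - 2 - m))) * e3

theorem sum_range_eq_auxHCertificate (q x y : ℚ) (d n : ℕ) (hn : n ≤ d) :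
    ∑ m ∈ Finset.range n, 1 / (m.factorial : ℚ) * fallingProd y m *
        ((y + 1 - (x + q)) * (y - (x + q)) *
          (risingProd (x - d) m * risingProd (q + 1) (d - m)
            + (y - d) * risingProd (x - d + 1) m * risingProd (q + 1) (d - 1 - m))
        - (x + q) * (x + q - 1) * (risingProd (x - d - 1) m * risingProd q (d - m)))
      = auxHCertificate q x y d n := by
  induction n with
  | zero => simp [auxHCertificate]
  | succ n ih =>
    obtain ⟨b, rfl⟩ : ∃ b, d = n + b + 1 := ⟨d - n - 1, by omega⟩
    rw [Finset.sum_range_succ, ih (by omega), ← eq_sub_iff_add_eq', auxHCertificate_sub,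
      show n + b + 1 - n = b + 1 by omega, show n + b + 1 - 1 - n = b by omega]

/-- The contiguity relation of the polynomials `auxH δ d` between `x` and `x - 1`. -/
theorem auxH_contiguous (δ : ℤ) (d : ℕ) (x y a : ℚ) (ha : a = 2 * x + δ) :
    (y + 1 - a) * (y - a) * (auxH δ (d + 1) x y + (y - (d + 1)) * auxH δ d x y)
      - a * (a - 1) * auxH δ (d + 1) (x - 1) y
    = fallingProd y (d + 2) / (d + 1).factorial
      * ((y + 1 - a) * fallingProd x (d + 1) - a * fallingProd (x - 1) (d + 1)) := by
  obtain ⟨q, hq⟩ : ∃ q : ℚ, q = x + δ := ⟨_, rfl⟩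
  obtain rfl : a = x + q := by rw [ha, hq]; ring
  -- The sum telescopes only below the top index; the summands with `m = d + 1`, where the
  -- lower-degree polynomial has no term, are added separately and combine with the certificate into
  -- falling factorials.
  have key := sum_range_eq_auxHCertificate q x y (d + 1) (d + 1) le_rfl
  rw [auxH_eq_sum, auxH_eq_sum, auxH_eq_sum, Finset.sum_range_succ _ (d + 1),
    Finset.sum_range_succ _ (d + 1), show x - 1 + δ + 1 = q by rw [hq]; ring, ← hq]
  simp only [auxHCertificate, Nat.sub_self, risingProd_zero, Nat.add_sub_cancel] at key ⊢
  have hsplit : ∑ m ∈ Finset.range (d + 1), 1 / (m.factorial : ℚ) * fallingProd y m *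
        ((y + 1 - (x + q)) * (y - (x + q)) *
          (risingProd (x - (d + 1 : ℕ)) m * risingProd (q + 1) (d + 1 - m)
            + (y - (d + 1 : ℕ)) * risingProd (x - (d + 1 : ℕ) + 1) m * risingProd (q + 1) (d - m))
        - (x + q) * (x + q - 1) * (risingProd (x - (d + 1 : ℕ) - 1) m * risingProd q (d + 1 - m)))
      = (y + 1 - (x + q)) * (y - (x + q)) *
        (∑ m ∈ Finset.range (d + 1), 1 / (m.factorial : ℚ) * risingProd (x - (d + 1 : ℕ)) m
            * risingProd (q + 1) (d + 1 - m) * fallingProd y m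
          + (y - (d + 1)) * ∑ m ∈ Finset.range (d + 1), 1 / (m.factorial : ℚ)
            * risingProd (x - d) m * risingProd (q + 1) (d - m) * fallingProd y m)
        - (x + q) * (x + q - 1) * ∑ m ∈ Finset.range (d + 1), 1 / (m.factorial : ℚ)
            * risingProd (x - 1 - (d + 1 : ℕ)) m * risingProd q (d + 1 - m) * fallingProd y m := by
    rw [Finset.mul_sum, ← Finset.sum_add_distrib, Finset.mul_sum, Finset.mul_sum,
      ← Finset.sum_sub_distrib]
    refine Finset.sum_congr rfl fun m _ => ?_
    rw [show x - ((d + 1 : ℕ) : ℚ) + 1 = x - d by push_cast; ring,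
      show x - ((d + 1 : ℕ) : ℚ) - 1 = x - 1 - (d + 1 : ℕ) by ring]
    push_cast
    ring
  rw [hsplit] at key
  have f1 := risingProd_sub_eq_fallingProd (x - 1) (d + 1)
  have f2 := risingProd_sub_eq_fallingProd x (d + 1)
  have f3 := risingProd_sub_eq_fallingProd x d
  have f4 := risingProd_sub_eq_fallingProd (x - 1) d
  have g1 := fallingProd_succ (x - 1) d
  have g2 := fallingProd_succ_left (x - 1) d
  rw [show x - 1 - (d : ℚ) = x - (d + 1 : ℕ) by push_cast; ring] at f4
  rw [show x - ((d + 1 : ℕ) : ℚ) + 1 = x - d by push_cast; ring, f3, f4] at key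
  rw [f1, f2, fallingProd_succ_left x d, fallingProd_succ y (d + 1), fallingProd_succ (x - 1 - 1) d]
  rw [g1] at g2
  rw [g1]
  set P := fallingProd (x - 1) d
  set R := fallingProd (x - 1 - 1) d
  set Y := fallingProd y (d + 1)
  set F := (((d + 1).factorial : ℕ) : ℚ)
  push_cast at *
  linear_combination key + 1 / F * Y * (x + q) * (x + q - 2 - d) * g2

/-- The degree-zero case of the contiguity relation, with the convention that the polynomial of
degree `-1` is zero. -/
theorem auxH_contiguous_zero (δ : ℤ) (x y a : ℚ) :
    (y + 1 - a) * (y - a) * auxH δ 0 x y - a * (a - 1) * auxH δ 0 (x - 1) y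
    = fallingProd y 1 / (0 : ℕ).factorial
      * ((y + 1 - a) * fallingProd x 0 - a * fallingProd (x - 1) 0) := by
  simp [auxH_zero_left, fallingProd]
  ring

/-- Where the first term of the contiguity relation vanishes, `auxH` factors completely. -/
theorem auxH_eq_fallingProd (δ : ℤ) (d : ℕ) (x y : ℚ) (hy : y = 2 * x + δ + 1) (hy0 : y + 1 ≠ 0)
    (hy1 : y ≠ 0) :
    auxH δ d x y = fallingProd (y - 1) d * fallingProd x d / d.factorial := by
  rcases d with _ | d
  · simp [auxH_zero_left, fallingProd_zero]
  -- Taken at `x + 1`, the relation has `a = y + 1`, so its first term drops out and the value at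
  -- `x` is isolated.
  · have h := auxH_contiguous δ d (x + 1) y (y + 1) (by rw [hy]; ring)
    rw [sub_self, zero_mul, zero_mul, zero_mul, zero_sub, zero_sub, add_sub_cancel_right,
      add_sub_cancel_right, fallingProd_succ_left y (d + 1)] at h
    refine mul_left_cancel₀ (mul_ne_zero hy0 hy1) ?_
    linear_combination -h

/-- At `d = x` the rising product starts at `0`, so only the term `m = 0` survives; at `d = x + 1`
it starts at `-1` and two terms survive. These values glue `auxH` to the binomial entries near the
antidiagonal. -/
theorem auxH_self (δ : ℤ) (x : ℕ) (y : ℚ) :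
    auxH δ x x y = risingProd (x + δ + 1) x := by
  rw [auxH_eq_sum, Finset.sum_range_succ', Finset.sum_eq_zero]
  · simp [risingProd_zero, fallingProd_zero]
  · intro m _
    rw [sub_self, risingProd_succ_left]
    ring

theorem auxH_self_succ (δ : ℤ) (x : ℕ) (y : ℚ) :
    auxH δ (x + 1) x y = risingProd (x + δ + 1) x * (2 * x + δ + 1 - y) := by
  rw [auxH_eq_sum, Finset.sum_range_succ', Finset.sum_range_succ', Finset.sum_eq_zero]
  · simp [risingProd_zero, fallingProd_zero, risingProd_succ, fallingProd_succ]
    ring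
  · intro m _
    rw [risingProd_succ_left, risingProd_succ_left]
    push_cast
    ring

/-! ### The common form of the normalising matrices. -/

open Nat in
/-- The common shape of the normalising matrices, in row `i` and column `j` (numbered from `1`),
with the two parts of the column `j < s / 2` separated by the antidiagonal `i + j = s`. -/
def normEntry (p s i j : ℕ) : ℚ :=
  if i < j ∨ p < i then 0
  else if 2 * j < s then
    if i + j ≤ s then (-1) ^ i * ((i - 1).choose (j - 1) : ℚ)
    else (-1) ^ (s + j) * ((i - 1)! / ((p + 2 * j - 1 - s)! * (s - 2 * j)!))
      * auxH ((s : ℤ) - p - 1) (p - i) ((p : ℚ) + j - s) p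
  else (-1) ^ j * ((p - j).choose (i - j) : ℚ)

theorem risingProd_natCast_add_one (q x : ℕ) :
    risingProd ((q : ℚ) + 1) x = (q + x).factorial / q.factorial := by
  have hq : (q.factorial : ℚ) ≠ 0 := by positivity
  rw [eq_div_iff hq]
  induction x with
  | zero => simp [risingProd_zero]
  | succ x ih =>
    rw [risingProd_succ, ← add_assoc, Nat.factorial_succ]
    push_cast
    rw [← ih]
    ring

open Nat in
theorem cast_choose_mul_factorial (n k m : ℕ) (h : n = k + m) :
    (n.choose k : ℚ) * (k ! * m !) = n ! := by
  subst h
  have := Nat.choose_mul_factorial_mul_factorial (Nat.le_add_right k m)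
  rw [Nat.add_sub_cancel_left, mul_assoc] at this
  exact_mod_cast this

open Nat in
theorem fallingProd_mul_factorial (n d : ℕ) : fallingProd ((n + d : ℕ) : ℚ) d * n ! = (n + d)! := by
  rw [fallingProd_natCast, ← cast_choose_mul_factorial (n + d) d n (add_comm _ _)]
  ring

open Nat in
/-- On and below the antidiagonal `i + j = s - 1`, the entries are given by `auxH`. -/
theorem normEntry_eq_auxH (b q x d p s i : ℕ) (hp : p = b + q + 1 + x) (hs : s = b + 2 * q + 2)
    (hi : i + d = p) (hi0 : 1 ≤ i) (hd : d ≤ x + 1) :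
    normEntry p s i (q + 1) = (-1) ^ (b + q + 1) * ((i - 1)! / ((x + q)! * b !))
      * auxH ((q : ℤ) - x) d x p := by
  have hδ : ((s : ℤ) - p - 1) = (q : ℤ) - x := by rw [hs, hp]; push_cast; ring
  have hx : ((p : ℚ) + (q + 1 : ℕ) - s) = x := by rw [hs, hp]; push_cast; ring
  have hdi : p - i = d := by omega
  have hq0 : (q ! : ℚ) ≠ 0 := by positivity
  have hb0 : (b ! : ℚ) ≠ 0 := by positivity
  have hxq0 : ((x + q)! : ℚ) ≠ 0 := by positivity
  -- The parameters are `b = s - 2j`, `x = p + j - s` and `d = p - i`, with `j = q + 1`. For `b = 0`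
  -- the column lies in the binomial regime, and `auxH` factors there.
  rcases Nat.eq_zero_or_pos b with hb | hb
  · subst hb
    have hH := auxH_eq_fallingProd ((q : ℤ) - x) d x p (by rw [hp]; push_cast; ring)
      (by positivity) (by rw [hp]; positivity)
    have hf : fallingProd (p - 1) d * (i - 1)! = (x + q)! := by
      have := fallingProd_mul_factorial (i - 1) d
      rw [show i - 1 + d = x + q by omega] at this
      rw [← this, hp]
      congr 2
      push_cast
      ring
    rw [hH, fallingProd_natCast]
    have hd0 : (d ! : ℚ) ≠ 0 := by positivity
    have : ((-1) ^ (0 + q + 1) * ((i - 1)! / ((x + q)! * (0)!))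
        * (fallingProd (p - 1) d * (d ! * (x.choose d : ℚ)) / d !))
        = (-1) ^ (q + 1) * (x.choose d : ℚ) := by
      rw [← hf] at hxq0 ⊢
      have := left_ne_zero_of_mul hxq0
      have := right_ne_zero_of_mul hxq0
      rw [zero_add, Nat.factorial_zero, Nat.cast_one]
      field_simp
    rw [this, normEntry]
    rcases Nat.lt_or_ge x d with h | h
    · rw [if_pos (by omega), Nat.choose_eq_zero_of_lt h]
      simp
    · rw [if_neg (by omega), if_neg (by omega), show p - (q + 1) = x by omega,
        show i - (q + 1) = x - d by omega, Nat.choose_symm h]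
  · obtain ⟨b, rfl⟩ : ∃ c, b = c + 1 := ⟨b - 1, by omega⟩
    rw [normEntry, if_neg (by omega), if_pos (by omega)]
    rcases Nat.lt_or_ge d x with h | h
    · rw [if_neg (by omega), hδ, hx, hdi, show p + 2 * (q + 1) - 1 - s = x + q by omega,
        show s - 2 * (q + 1) = b + 1 by omega, hs,
        show b + 1 + 2 * q + 2 + (q + 1) = b + 1 + q + 1 + 2 * (q + 1) by ring, pow_add _ _ (2 * _)]
      simp
    -- On the antidiagonals `s` and `s - 1` the entry is defined as a signed binomial, and the
    -- special values of `auxH` reproduce it.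
    · rw [if_pos (by omega)]
      rcases Nat.lt_or_ge x d with h | h
      · obtain rfl : d = x + 1 := by omega
        obtain rfl : i = b + 1 + q := by omega
        rw [auxH_self_succ, show (x : ℚ) + ((q : ℤ) - x : ℤ) + 1 = q + 1 by push_cast; ring,
          risingProd_natCast_add_one, hp, show b + 1 + q - 1 = b + q by omega, add_comm q x,
          show q + 1 - 1 = q by omega, ← cast_choose_mul_factorial (b + q) q b (by ring),
          Nat.factorial_succ b]
        have hb0 : (b ! : ℚ) ≠ 0 := by positivity
        rw [add_comm x q] at hxq0
        push_cast
        field_simp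
        ring
      · obtain rfl : d = x := by omega
        obtain rfl : i = b + 1 + q + 1 := by omega
        rw [auxH_self, show (d : ℚ) + ((q : ℤ) - d : ℤ) + 1 = q + 1 by push_cast; ring,
          risingProd_natCast_add_one, show b + 1 + q + 1 - 1 = b + 1 + q by omega, add_comm q d,
          show q + 1 - 1 = q by omega, ← cast_choose_mul_factorial (b + 1 + q) q (b + 1) (by ring)]
        field_simp

/-! ### The column recurrence. -/

open Nat in
/-- The column recurrence away from the boundary of the index range. -/
theorem normEntry_recurrence_auxH (b q x d p s i : ℕ) (hp : p = b + q + 1 + 1 + (x + 1))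
    (hs : s = b + 2 * (q + 1) + 2) (hi : i + d = p) (hi0 : 1 ≤ i) (hd : d ≤ x + 1) :
    normEntry p s i (q + 2) + normEntry p s (i + 1) (q + 2) + normEntry p s i (q + 1)
      = (-1) ^ (b + q) * (p.choose (b + 1) * ((x + 1).choose d)
        - p.choose (b + 2) * (x.choose d) : ℚ) := by
  have h1 := normEntry_eq_auxH b (q + 1) (x + 1) d p s i (by omega) hs hi hi0 (by omega)
  have h2 := normEntry_eq_auxH (b + 2) q x d p s i (by omega) (by omega) hi hi0 (by omega)
  have c1 := cast_choose_mul_factorial p (b + 1) (x + q + 2) (by omega)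
  have c2 := cast_choose_mul_factorial p (b + 2) (x + q + 1) (by omega)
  have c3 : fallingProd p (d + 1) * (i - 1)! = p ! := by
    have := fallingProd_mul_factorial (i - 1) (d + 1)
    rwa [show i - 1 + (d + 1) = p by omega] at this
  have c4 := fallingProd_natCast (x + 1) d
  have c5 := fallingProd_natCast x d
  have hpQ : (p : ℚ) = b + q + x + 3 := by rw [hp]; push_cast; ring
  have hW : ((i - 1)! : ℚ) ≠ 0 := by positivity
  have hu : (b ! : ℚ) ≠ 0 := by positivity
  have hv : ((x + q)! : ℚ) ≠ 0 := by positivity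
  have hd0 : (d ! : ℚ) ≠ 0 := by positivity
  have hδ : (((q + 1 : ℕ) : ℤ) - ((x + 1 : ℕ) : ℤ)) = (q : ℤ) - x := by push_cast; ring
  -- The multiplier clears the factorials of both columns and leaves the coefficients `(y + 1 - a)
  -- (y - a)` and `a (a - 1)` of the contiguity relation at `y = p`, `a = x + q + 2`. The entry in
  -- row `i + 1` carries the extra factor `i = p - d`, which is the coefficient of the lower-degree
  -- polynomial.
  have key : ((b : ℚ) + 2) * (b + 1) * (((x : ℚ) + q + 2) * (x + q + 1) * (x + q)! * b ! / (i - 1)!)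
        * (normEntry p s i (q + 2) + normEntry p s (i + 1) (q + 2) + normEntry p s i (q + 1))
      = (-1) ^ (b + q) * fallingProd p (d + 1)
        * ((b + 2) * ((x + 1).choose d : ℚ) - (x + q + 2) * (x.choose d : ℚ)) := by
    rw [show x + 1 + (q + 1) = x + q + 2 by ring] at h1
    simp only [Nat.factorial_succ] at h1 h2
    rcases d with _ | e
    · have hlast : normEntry p s (i + 1) (q + 2) = 0 := by rw [normEntry, if_pos (by omega)]
      have H := auxH_contiguous_zero ((q : ℤ) - x) ((x + 1 : ℕ) : ℚ) p (x + q + 2)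
      rw [h1, h2, hlast, hδ]
      rw [show ((x + 1 : ℕ) : ℚ) - 1 = x by push_cast; ring, fallingProd_zero, fallingProd_zero,
        Nat.factorial_zero, Nat.cast_one, div_one] at H
      simp only [Nat.choose_zero_right, Nat.cast_one, hpQ] at H ⊢
      push_cast at H ⊢
      field_simp
      linear_combination (i - 1)! * (b + 2) * (x + q + 2) * (-1) ^ (b + q) * H
    · have h3 := normEntry_eq_auxH b (q + 1) (x + 1) e p s (i + 1) (by omega) hs (by omega)
        (by omega) (by omega)
      have H := auxH_contiguous ((q : ℤ) - x) e ((x + 1 : ℕ) : ℚ) p (x + q + 2)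
        (by push_cast; ring)
      obtain ⟨l, rfl⟩ : ∃ l, i = l + 1 := ⟨i - 1, by omega⟩
      rw [show x + 1 + (q + 1) = x + q + 2 by ring] at h3
      rw [show ((x + 1 : ℕ) : ℚ) - 1 = x by push_cast; ring, c4, c5] at H
      simp only [Nat.factorial_succ, Nat.add_sub_cancel] at h1 h2 h3 H ⊢
      rw [h1, h2, h3, hδ]
      have hl : (l : ℚ) = p - (e + 1) - 1 := by rw [← hi]; push_cast; ring
      have hb1 : (p : ℚ) + 1 - (x + q + 2) = b + 2 := by rw [hpQ]; ring
      have hb2 : (p : ℚ) - (x + q + 2) = b + 1 := by rw [hpQ]; ring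
      rw [← Nat.factorial_succ, mul_left_comm _ ((e + 1)! : ℚ), mul_left_comm _ ((e + 1)! : ℚ),
        ← mul_sub, ← mul_assoc, div_mul_cancel₀ _ hd0, hb1, hb2] at H
      push_cast at H ⊢
      field_simp
      rw [hl]
      linear_combination (b + 2) * (x + q + 2) * (-1) ^ (b + q) * H
  have e1 : ((b : ℚ) + 2) * (b + 1) * (((x : ℚ) + q + 2) * (x + q + 1) * (x + q)! * b ! / (i - 1)!)
      * p.choose (b + 1) = (b + 2) * fallingProd p (d + 1) := by
    rw [← c3, Nat.factorial_succ, Nat.factorial_succ, Nat.factorial_succ] at c1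
    push_cast at c1
    field_simp
    linear_combination c1
  have e2 : ((b : ℚ) + 2) * (b + 1) * (((x : ℚ) + q + 2) * (x + q + 1) * (x + q)! * b ! / (i - 1)!)
      * p.choose (b + 2) = (x + q + 2) * fallingProd p (d + 1) := by
    rw [← c3, Nat.factorial_succ, Nat.factorial_succ, Nat.factorial_succ] at c2
    push_cast at c2
    field_simp
    linear_combination c2
  refine mul_left_cancel₀ ?_ (key.trans ?_)
  · positivity
  · linear_combination (-1) ^ (b + q) * (x.choose d : ℚ) * e2
      - (-1) ^ (b + q) * ((x + 1).choose d : ℚ) * e1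

theorem normEntry_of_lt (p s i j : ℕ) (h : i < j ∨ p < i) : normEntry p s i j = 0 := if_pos h

/-- With lower index `p - i` instead of `i - k`, the binomial vanishes by itself above the diagonal,
so no case distinction on `i < k` is needed later. -/
theorem normEntry_of_le_two_mul (p s i k : ℕ) (hs : s ≤ 2 * k) (hk : k ≤ p) (hi : i ≤ p) :
    normEntry p s i k = (-1) ^ k * ((p - k).choose (p - i) : ℚ) := by
  rw [normEntry]
  split_ifs with h1 h2
  · rw [Nat.choose_eq_zero_of_lt (by omega)]
    simp
  · omega
  · omega
  · rw [← Nat.choose_symm (show i - k ≤ p - k by omega), show p - k - (i - k) = p - i by omega]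

theorem normEntry_of_add_le (p s i j : ℕ) (h : i + j ≤ s) (hi : 1 ≤ i) (hip : i ≤ p) :
    normEntry p s i j = (-1) ^ i * ((i - 1).choose (j - 1) : ℚ) := by
  rw [normEntry]
  split_ifs with h1 h2
  · rw [Nat.choose_eq_zero_of_lt (by omega)]
    simp
  · rfl
  · obtain rfl : i = j := by omega
    simp

theorem normEntry_self (p s i : ℕ) (hi : i ≤ p) : normEntry p s i i = (-1) ^ i := by
  rw [normEntry]
  split_ifs <;> first | omega | simp

/-- Minus the part on and below the diagonal of the one-step matrix `S⁻¹ M_{k+1} M_{k+1/2}`,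
where `S` is the twisted shift and `s = p + 2 k`. -/
def staircaseEntry (p s k j : ℕ) : ℚ :=
  if j ≤ k ∧ (k + j = s ∨ k + j = s + 1 ∨ (k = p ∧ j = 1)) then (p.choose (k + 1 - j) : ℚ) else 0

theorem sum_mul_ite_add_eq (p j t : ℕ) (hj : 1 ≤ j) (f c : ℕ → ℚ) :
    ∑ k ∈ Finset.Icc 1 p, f k * (if k + j = t ∧ j ≤ k then c k else 0)
      = if 2 * j ≤ t ∧ t ≤ p + j then f (t - j) * c (t - j) else 0 := by
  split_ifs with h
  · rw [Finset.sum_eq_single_of_mem (t - j) (Finset.mem_Icc.2 (by omega)), if_pos (by omega)]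
    intro k _ hk
    rw [if_neg (by omega), mul_zero]
  · refine Finset.sum_eq_zero fun k hk => ?_
    rw [Finset.mem_Icc] at hk
    rw [if_neg (by omega), mul_zero]

/-- Each antidiagonal meets column `j` at most once. The corner `(p, 1)` already lies on one of the
two antidiagonals when `s = p` or `s = p + 1`, so it is counted separately only otherwise. -/
theorem sum_mul_staircaseEntry (p s j : ℕ) (hp : 1 ≤ p) (hj : 1 ≤ j) (f : ℕ → ℚ) :
    ∑ k ∈ Finset.Icc 1 p, f k * staircaseEntry p s k j
      = (if 2 * j ≤ s ∧ s ≤ p + j then f (s - j) * (p.choose (s - j + 1 - j) : ℚ) else 0)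
      + (if 2 * j ≤ s + 1 ∧ s + 1 ≤ p + j then
          f (s + 1 - j) * (p.choose (s + 1 - j + 1 - j) : ℚ) else 0)
      + (if j = 1 ∧ s ≠ p ∧ s ≠ p + 1 then f p else 0) := by
  rw [← sum_mul_ite_add_eq p j s hj f fun k => (p.choose (k + 1 - j) : ℚ),
    ← sum_mul_ite_add_eq p j (s + 1) hj f fun k => (p.choose (k + 1 - j) : ℚ)]
  have h3 : (if j = 1 ∧ s ≠ p ∧ s ≠ p + 1 then f p else 0)
      = ∑ k ∈ Finset.Icc 1 p, f k * (if k = p ∧ j = 1 ∧ s ≠ p ∧ s ≠ p + 1 then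
          (p.choose (k + 1 - j) : ℚ) else 0) := by
    rw [Finset.sum_eq_single_of_mem p (Finset.mem_Icc.2 (by omega))]
    · split_ifs with h1 h2 h2
      · rw [h1.1]
        simp
      · omega
      · omega
      · simp
    · intro k _ hk
      rw [if_neg (by omega), mul_zero]
  rw [h3, ← Finset.sum_add_distrib, ← Finset.sum_add_distrib]
  refine Finset.sum_congr rfl fun k hk => ?_
  rw [← mul_add, ← mul_add, staircaseEntry]
  congr 1
  split_ifs <;> first | omega | simp

open Nat in
/-- The boundary of the two regimes for odd `s`. -/
theorem normEntry_recurrence_middle (q x d p s i : ℕ) (hp : p = q + 2 + x)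
    (hs : s = 2 * q + 3) (hi : i + d = p) (hi0 : 1 ≤ i) :
    normEntry p s i (q + 2) + normEntry p s (i + 1) (q + 2) + normEntry p s i (q + 1)
      = normEntry p s i (q + 2) * p := by
  rw [normEntry_of_le_two_mul p s i (q + 2) (by omega) (by omega) (by omega),
    show p - (q + 2) = x by omega, show p - i = d by omega]
  have hpascal : normEntry p s (i + 1) (q + 2)
      = (-1) ^ (q + 2) * ((x + 1).choose d - x.choose d : ℚ) := by
    rcases d with _ | e
    · rw [normEntry_of_lt _ _ _ _ (by omega)]
      simp
    · rw [normEntry_of_le_two_mul p s (i + 1) (q + 2) (by omega) (by omega) (by omega),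
        show p - (q + 2) = x by omega, show p - (i + 1) = e by omega, Nat.choose_succ_succ]
      push_cast
      ring
  rw [hpascal]
  have key : normEntry p s i (q + 1)
      = (-1) ^ (q + 2) * (p * (x.choose d : ℚ) - (x + 1).choose d) := by
    rcases Nat.lt_or_ge (x + 1) d with h | h
    · rw [normEntry_of_lt _ _ _ _ (by omega), Nat.choose_eq_zero_of_lt h,
        Nat.choose_eq_zero_of_lt (by omega)]
      simp
    · rw [normEntry_eq_auxH 1 q x d p s i (by omega) (by omega) hi hi0 h]
      have hpQ : (p : ℚ) = q + x + 2 := by rw [hp]; push_cast; ring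
      have H : (p : ℚ) * (p - 1) * auxH ((q : ℤ) - x) d x p
          = fallingProd p (d + 1) * (p * (x.choose d : ℚ) - (x + 1).choose d) := by
        have c1 := fallingProd_natCast (x + 1) d
        have c2 := fallingProd_natCast x d
        have hd0 : (d ! : ℚ) ≠ 0 := by positivity
        have hx : ((x + 1 : ℕ) : ℚ) - 1 = x := by push_cast; ring
        -- Here `y = a = p`, so the factor `y - a` removes the two polynomials at `x + 1` and leaves
        -- a closed form for the one at `x`.
        have H : (p + 1 - p) * 0 - (p : ℚ) * (p - 1) * auxH ((q : ℤ) - x) d x p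
            = fallingProd p (d + 1) / d !
              * ((p + 1 - p) * fallingProd (x + 1 : ℕ) d - p * fallingProd x d) := by
          rcases d with _ | e
          · have := auxH_contiguous_zero ((q : ℤ) - x) ((x + 1 : ℕ) : ℚ) p p
            rwa [hx, sub_self, mul_zero, zero_mul, ← mul_zero ((p : ℚ) + 1 - p)] at this
          · have := auxH_contiguous ((q : ℤ) - x) e ((x + 1 : ℕ) : ℚ) p p
              (by rw [hpQ]; push_cast; ring)
            rwa [hx, sub_self, mul_zero, zero_mul, ← mul_zero ((p : ℚ) + 1 - p)] at this
        rw [c1, c2] at H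
        field_simp at H
        linear_combination -H
      have c3 : fallingProd p (d + 1) * (i - 1)! = p ! := by
        have := fallingProd_mul_factorial (i - 1) (d + 1)
        rwa [show i - 1 + (d + 1) = p by omega] at this
      have c4 : (p ! : ℚ) = p * (p - 1) * (x + q)! := by
        rw [hpQ, show p = x + q + 1 + 1 by omega, Nat.factorial_succ, Nat.factorial_succ]
        push_cast
        ring
      have hp1 : (p : ℚ) - 1 ≠ 0 := by
        rw [hpQ, show (q : ℚ) + x + 2 - 1 = q + x + 1 by ring]
        positivity
      have hp0 : (p : ℚ) ≠ 0 := by rw [hpQ]; positivity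
      have hv : ((x + q)! : ℚ) ≠ 0 := by positivity
      refine mul_left_cancel₀ (mul_ne_zero (mul_ne_zero hp0 hp1) hv) ?_
      have e : (p : ℚ) * (p - 1) * (x + q)! * ((-1) ^ (1 + q + 1) * ((i - 1)! / ((x + q)! * 1 !))
          * auxH ((q : ℤ) - x) d x p)
          = (-1) ^ (1 + q + 1) * (i - 1)! * (p * (p - 1) * auxH ((q : ℤ) - x) d x p) := by
        rw [Nat.factorial_one, Nat.cast_one, mul_one]
        field_simp
      rw [e, H]
      linear_combination (-1) ^ q * (p * (x.choose d : ℚ) - (x + 1).choose d) * (c3 + c4)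
  rw [key]
  ring

-- In the first column there is no column to the left for the contiguity relation to use. Only the
-- rows `i ≥ s - 1` are involved, at most three of them, and each is computed explicitly.
open Nat in
theorem normEntry_recurrence_left_column (p s i : ℕ) (hs : s = p ∨ s + 1 = p) (hs2 : 2 ≤ s)
    (hip : i ≤ p) (his : s ≤ i + 1) :
    normEntry p s i 1 + normEntry p s (i + 1) 1
      = normEntry p s i (s - 1) * (p.choose (s - 1) : ℚ) + normEntry p s i s * (p.choose s : ℚ)
        + if s = p then 0 else normEntry p s i p := by
  obtain ⟨b, rfl⟩ : ∃ b, s = b + 2 := ⟨s - 2, by omega⟩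
  have hb : (b ! : ℚ) ≠ 0 := by positivity
  rcases hs with rfl | rfl
  · have hB : ∀ k, k = b + 1 ∨ k = b + 2 → normEntry (b + 2) (b + 2) i k
        = (-1) ^ k * ((b + 2 - k).choose (b + 2 - i) : ℚ) := fun k hk =>
      normEntry_of_le_two_mul _ _ _ _ (by omega) (by omega) hip
    have h0 : normEntry (b + 2) (b + 2) (b + 2) 1 = (-1) ^ (b + 1) * (b + 1) := by
      rw [normEntry_eq_auxH b 0 1 0 (b + 2) (b + 2) (b + 2) (by omega) (by omega) (by omega)
        (by omega) (by omega), auxH_zero_left, show b + 2 - 1 = b + 1 by omega, Nat.factorial_succ]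
      push_cast
      simp
      field_simp
    have h1 : normEntry (b + 2) (b + 2) (b + 1) 1 = (-1) ^ (b + 1) := by
      rw [normEntry_of_add_le _ _ _ _ (by omega) (by omega) (by omega)]
      simp
    rw [if_pos rfl, show b + 2 - 1 = b + 1 by omega, hB _ (Or.inl rfl), hB _ (Or.inr rfl),
      show b + 2 - (b + 1) = 1 by omega, Nat.sub_self, Nat.choose_succ_self_right,
      Nat.choose_self]
    have h : i = b + 2 ∨ i = b + 1 := by omega
    rcases h with rfl | rfl
    · rw [normEntry_of_lt (b + 2) (b + 2) (b + 2 + 1) 1 (by omega), h0, Nat.sub_self]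
      simp
      ring
    · rw [h0, h1, show b + 2 - (b + 1) = 1 by omega]
      simp
      ring
  · have hB : ∀ k, k = b + 1 ∨ k = b + 2 ∨ k = b + 3 → normEntry (b + 3) (b + 2) i k
        = (-1) ^ k * ((b + 3 - k).choose (b + 3 - i) : ℚ) := fun k hk =>
      normEntry_of_le_two_mul _ _ _ _ (by omega) (by omega) hip
    have h0 : normEntry (b + 3) (b + 2) (b + 3) 1 = (-1) ^ (b + 1) * ((b + 2) * (b + 1) / 2) := by
      rw [normEntry_eq_auxH b 0 2 0 (b + 3) (b + 2) (b + 3) (by omega) (by omega) (by omega)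
        (by omega) (by omega), auxH_zero_left, show b + 3 - 1 = b + 1 + 1 by omega,
        Nat.factorial_succ, Nat.factorial_succ]
      push_cast
      simp [Nat.factorial]
      field_simp
      ring
    have h1 : normEntry (b + 3) (b + 2) (b + 2) 1 = (-1) ^ (b + 1) * ((b + 1) * (b + 4) / 2) := by
      rw [normEntry_eq_auxH b 0 2 1 (b + 3) (b + 2) (b + 2) (by omega) (by omega) (by omega)
        (by omega) (by omega), auxH_sub_one, auxH_zero_left, show b + 2 - 1 = b + 1 by omega,
        Nat.factorial_succ, auxH]
      simp [Finset.sum_range_succ, Nat.factorial]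
      field_simp
      ring
    have h2 : normEntry (b + 3) (b + 2) (b + 1) 1 = (-1) ^ (b + 1) := by
      rw [normEntry_of_add_le _ _ _ _ (by omega) (by omega) (by omega)]
      simp
    have hc : ((b + 3).choose (b + 1) : ℚ) = (b + 3) * (b + 2) / 2 := by
      rw [← Nat.choose_symm (by omega), show b + 3 - (b + 1) = 2 by omega, Nat.cast_choose_two]
      push_cast
      ring
    rw [if_neg (by omega), show b + 2 - 1 = b + 1 by omega, hB _ (Or.inl rfl),
      hB _ (Or.inr (Or.inl rfl)), hB _ (Or.inr (Or.inr rfl)),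
      show b + 3 - (b + 1) = 2 by omega, show b + 3 - (b + 2) = 1 by omega, Nat.sub_self,
      Nat.choose_succ_self_right, hc]
    have h : i = b + 3 ∨ i = b + 2 ∨ i = b + 1 := by omega
    rcases h with rfl | rfl | rfl
    · rw [normEntry_of_lt (b + 3) (b + 2) (b + 3 + 1) 1 (by omega), h0, Nat.sub_self]
      simp
      ring
    · rw [h0, h1, show b + 3 - (b + 2) = 1 by omega]
      simp
      ring
    · rw [h1, h2, show b + 3 - (b + 1) = 2 by omega]
      simp
      ring

/-- The column recurrence satisfied by the normalising matrices. -/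
theorem normEntry_recurrence (p s i j : ℕ) (hs : p ≤ s + 1) (hs' : s ≤ p + 2)
    (hi : 1 ≤ i) (hip : i ≤ p) (hj : 1 ≤ j) (hjp : j ≤ p) :
    normEntry p s i j + normEntry p s (i + 1) j + (if j = 1 then 0 else normEntry p s i (j - 1))
      = ∑ k ∈ Finset.Icc 1 p, normEntry p s i k * staircaseEntry p s k j := by
  rw [sum_mul_staircaseEntry p s j (by omega) hj]
  rcases Nat.lt_or_ge s (2 * j) with hsj | hsj
  · -- the part on the right, where all the entries are binomial coefficients of `p - j`
    rcases Nat.eq_or_lt_of_le hj with rfl | hj1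
    -- Column 1 belongs to the right part only when `s ≤ 1`, which leaves three degenerate sizes.
    · have h : p = 1 ∧ s = 1 ∨ p = 1 ∧ s = 0 ∨ p = 2 ∧ s = 1 := by omega
      rcases h with ⟨rfl, rfl⟩ | ⟨rfl, rfl⟩ | ⟨rfl, rfl⟩ <;> interval_cases i <;>
        norm_num [normEntry]
    · rw [if_neg (show ¬ j = 1 by omega), if_neg (show ¬ (2 * j ≤ s ∧ s ≤ p + j) by omega),
        if_neg (show ¬ (j = 1 ∧ s ≠ p ∧ s ≠ p + 1) by omega)]
      obtain ⟨q, rfl⟩ : ∃ q, j = q + 2 := ⟨j - 2, by omega⟩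
      rcases Nat.eq_or_lt_of_le hsj with h | h
      · rw [if_pos (by omega), show s + 1 - (q + 2) = q + 2 by omega,
          show q + 2 + 1 - (q + 2) = 1 by omega, Nat.choose_one_right, zero_add, add_zero]
        exact normEntry_recurrence_middle q (p - (q + 2)) (p - i) p s i (by omega) (by omega)
          (by omega) hi
      · rw [if_neg (by omega), show q + 2 - 1 = q + 1 by omega,
          normEntry_of_le_two_mul p s i (q + 2) (by omega) (by omega) (by omega),
          normEntry_of_le_two_mul p s i (q + 1) (by omega) (by omega) (by omega)]
        rcases Nat.eq_or_lt_of_le hip with rfl | h'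
        · rw [normEntry_of_lt _ _ _ _ (by omega)]
          simp
          ring
        · rw [normEntry_of_le_two_mul p s (i + 1) (q + 2) (by omega) (by omega) (by omega),
            show p - (q + 1) = p - (q + 2) + 1 by omega, show p - i = p - (i + 1) + 1 by omega,
            Nat.choose_succ_succ]
          push_cast
          ring
  rcases Nat.lt_or_ge (i + j) s with hijs | hijs
  · -- above the antidiagonal
    -- The antidiagonal terms involve columns beyond `i`, where the row is zero; only the corner can
    -- contribute, namely for `i = p`, `j = 1`, `s = p + 2`.
    have h1 : ∀ t, s ≤ t → normEntry p s i (t - j) = 0 :=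
      fun t ht => normEntry_of_lt _ _ _ _ (by omega)
    rw [h1 s le_rfl, h1 (s + 1) (by omega)]
    simp only [zero_mul, ite_self, zero_add]
    rw [normEntry_of_add_le p s i j (by omega) hi hip]
    rcases Nat.eq_or_lt_of_le hip with rfl | h'
    · obtain rfl : j = 1 := by omega
      rw [normEntry_of_lt _ _ (i + 1) _ (by omega), if_pos rfl, if_pos (by omega),
        normEntry_self i s i le_rfl]
      simp
    · rw [normEntry_of_add_le p s (i + 1) j (by omega) (by omega) (by omega)]
      obtain ⟨l, rfl⟩ : ∃ l, i = l + 1 := ⟨i - 1, by omega⟩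
      have h2 : (if j = 1 ∧ s ≠ p ∧ s ≠ p + 1 then normEntry p s (l + 1) p else 0) = 0 := by
        rw [normEntry_of_lt p s (l + 1) p (by omega), ite_self]
      rw [h2]
      rcases Nat.eq_or_lt_of_le hj with rfl | hj1
      · simp
        ring
      · rw [if_neg (by omega), normEntry_of_add_le p s (l + 1) (j - 1) (by omega) hi hip]
        obtain ⟨q, rfl⟩ : ∃ q, j = q + 2 := ⟨j - 2, by omega⟩
        simp only [Nat.add_sub_cancel, show q + 2 - 1 = q + 1 by omega]
        rw [Nat.choose_succ_succ]
        push_cast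
        ring
  · rcases Nat.eq_or_lt_of_le (show s ≤ p + j by omega) with hx | hx
    · -- the last row, when the antidiagonal passes through it
      obtain rfl : i = p := by omega
      rw [normEntry_of_lt i s (i + 1) j (by omega), if_pos (show 2 * j ≤ s ∧ s ≤ i + j by omega),
        if_neg (show ¬ (2 * j ≤ s + 1 ∧ s + 1 ≤ i + j) by omega),
        if_neg (show ¬ (j = 1 ∧ s ≠ i ∧ s ≠ i + 1) by omega), show s - j = i by omega,
        normEntry_of_le_two_mul i s i i (by omega) le_rfl le_rfl,
        normEntry_of_add_le i s i j (by omega) hi le_rfl]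
      have h : j = 1 ∨ j = 2 := by omega
      rcases h with rfl | rfl
      · simp
      · rw [if_neg (by omega), normEntry_of_add_le i s i (2 - 1) (by omega) hi le_rfl]
        obtain ⟨l, rfl⟩ : ∃ l, i = l + 2 := ⟨i - 2, by omega⟩
        have : (l + 2 + 1 - 2) = l + 1 := by omega
        rw [this, ← Nat.choose_symm (show l + 1 ≤ l + 2 by omega)]
        simp
        ring
    · rw [if_pos (show 2 * j ≤ s ∧ s ≤ p + j by omega),
        if_pos (show 2 * j ≤ s + 1 ∧ s + 1 ≤ p + j by omega)]
      rcases Nat.eq_or_lt_of_le hj with rfl | hj1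
      · have := normEntry_recurrence_left_column p s i (by omega) hsj hip hijs
        rw [if_pos rfl, add_zero, this, show s - 1 + 1 - 1 = s - 1 by omega,
          show s + 1 - 1 + 1 - 1 = s by omega, show s + 1 - 1 = s by omega]
        congr 1
        split_ifs <;> first | omega | rfl
      · obtain ⟨b, hb⟩ : ∃ b, s = b + 2 * j := ⟨s - 2 * j, by omega⟩
        obtain ⟨q, rfl⟩ : ∃ q, j = q + 2 := ⟨j - 2, by omega⟩
        obtain ⟨x, hx⟩ : ∃ x, p = b + q + 1 + 1 + (x + 1) := ⟨p - (b + q + 3), by omega⟩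
        rw [if_neg (show ¬ q + 2 = 1 by omega),
          if_neg (show ¬ (q + 2 = 1 ∧ s ≠ p ∧ s ≠ p + 1) by omega),
          show q + 2 - 1 = q + 1 by omega,
          normEntry_recurrence_auxH b q x (p - i) p s i hx (by omega) (by omega) hi (by omega),
          normEntry_of_le_two_mul p s i (s - (q + 2)) (by omega) (by omega) (by omega),
          normEntry_of_le_two_mul p s i (s + 1 - (q + 2)) (by omega) (by omega) (by omega),
          show s - (q + 2) + 1 - (q + 2) = b + 1 by omega,
          show s + 1 - (q + 2) + 1 - (q + 2) = b + 2 by omega,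
          show s - (q + 2) = b + q + 2 by omega, show s + 1 - (q + 2) = b + q + 3 by omega,
          show p - (b + q + 2) = x + 1 by omega, show p - (b + q + 3) = x by omega]
        ring

/-! ### The twisted shift and its action on the crossing matrices. -/

/-- The shift of the coordinates, with the last basis vector sent to minus the first one. -/
def twistedShift (p : ℕ) : Matrix (Fin p) (Fin p) ℚ :=
  Matrix.of fun a b =>
    if (a : ℕ) = b + 1 then 1 else if (a : ℕ) = 0 ∧ (b : ℕ) + 1 = p then -1 else 0

/-- The matrix with the given entry function, with rows and columns numbered from `0`. -/
def natMatrix (p : ℕ) (f : ℕ → ℕ → ℚ) : Matrix (Fin p) (Fin p) ℚ := Matrix.of fun a b => f a b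

theorem natMatrix_congr (p : ℕ) (f g : ℕ → ℕ → ℚ) (h : ∀ a b, a < p → b < p → f a b = g a b) :
    natMatrix p f = natMatrix p g := by
  ext a b
  exact h a b a.2 b.2

theorem one_eq_natMatrix (p : ℕ) :
    (1 : Matrix (Fin p) (Fin p) ℚ) = natMatrix p fun a b => if a = b then 1 else 0 := by
  ext a b
  simp [natMatrix, Matrix.one_apply, Fin.ext_iff]

theorem natMatrix_mul (p : ℕ) (f g : ℕ → ℕ → ℚ) :
    natMatrix p f * natMatrix p g
      = natMatrix p fun a b => ∑ c ∈ Finset.range p, f a c * g c b := by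
  ext a b
  simp only [natMatrix, Matrix.mul_apply, Matrix.of_apply]
  exact Fin.sum_univ_eq_sum_range (fun c => f a c * g c b) p

theorem natMatrix_sub (p : ℕ) (f g : ℕ → ℕ → ℚ) :
    natMatrix p f - natMatrix p g = natMatrix p fun a b => f a b - g a b := rfl

theorem natMatrix_add (p : ℕ) (f g : ℕ → ℕ → ℚ) :
    natMatrix p f + natMatrix p g = natMatrix p fun a b => f a b + g a b := rfl

theorem twistedShift_mul_natMatrix (p : ℕ) (f : ℕ → ℕ → ℚ) :
    twistedShift p * natMatrix p f
      = natMatrix p fun a b => if a = 0 then -f (p - 1) b else f (a - 1) b := by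
  ext a b
  rw [Matrix.mul_apply]
  have ha := a.2
  simp only [natMatrix, twistedShift, Matrix.of_apply]
  split_ifs with h
  · rw [Finset.sum_eq_single_of_mem (⟨p - 1, by omega⟩ : Fin p) (Finset.mem_univ _)]
    · rw [if_neg (by omega), if_pos ⟨h, by simp only; omega⟩, neg_one_mul]
    · intro c _ hc
      rw [if_neg (by omega), if_neg, zero_mul]
      rintro ⟨-, h2⟩
      exact hc (Fin.ext (by simp only; omega))
  · rw [Finset.sum_eq_single_of_mem (⟨a - 1, by omega⟩ : Fin p) (Finset.mem_univ _)]
    · rw [if_pos (by simp only; omega), one_mul]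
    · intro c _ hc
      rw [if_neg, if_neg (by omega), zero_mul]
      intro h2
      exact hc (Fin.ext (by simp only; omega))

theorem natMatrix_mul_twistedShift (p : ℕ) (f : ℕ → ℕ → ℚ) :
    natMatrix p f * twistedShift p
      = natMatrix p fun a b => if b + 1 = p then -f a 0 else f a (b + 1) := by
  ext a b
  rw [Matrix.mul_apply]
  have hb := b.2
  simp only [natMatrix, twistedShift, Matrix.of_apply]
  split_ifs with h
  · rw [Finset.sum_eq_single_of_mem (⟨0, by omega⟩ : Fin p) (Finset.mem_univ _)]
    · rw [if_neg (by simp only; omega), if_pos ⟨rfl, h⟩, mul_neg_one]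
    · intro c _ hc
      have hc' := c.2
      rw [if_neg (by omega), if_neg, mul_zero]
      rintro ⟨h2, -⟩
      exact hc (Fin.ext h2)
  · rw [Finset.sum_eq_single_of_mem (⟨b + 1, by omega⟩ : Fin p) (Finset.mem_univ _)]
    · rw [if_pos rfl, mul_one]
    · intro c _ hc
      rw [if_neg, if_neg (by omega), mul_zero]
      intro h2
      exact hc (Fin.ext h2)

theorem twistedShift_pow (p n : ℕ) (hn : n ≤ p) :
    twistedShift p ^ n
      = natMatrix p fun a b => if a = b + n then 1 else if a + p = b + n then -1 else 0 := by
  induction n with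
  | zero =>
    rw [pow_zero, one_eq_natMatrix]
    refine natMatrix_congr _ _ _ fun a b ha hb => ?_
    split_ifs <;> first | omega | rfl
  | succ n ih =>
    rw [pow_succ', ih (by omega), twistedShift_mul_natMatrix]
    refine natMatrix_congr _ _ _ fun a b ha hb => ?_
    split_ifs <;> first | omega | simp

theorem twistedShift_pow_self (p : ℕ) : twistedShift p ^ p = -1 := by
  rw [twistedShift_pow p p le_rfl, one_eq_natMatrix]
  ext a b
  have := a.2
  simp only [natMatrix, Matrix.of_apply, Matrix.neg_apply]
  split_ifs <;> first | omega | simp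

/-- The entries of the simple-crossing matrices for arbitrary integer row and column numbers. -/
noncomputable def crossingEntry (p : ℕ) (k : ℚ) (i j : ℤ) : ℚ :=
  if i = j then 1
  else if Int.fract ((i + j - 2 * k) / p) = 0 ∧
      Int.fract ((j - k) / p) < Int.fract ((i - k) / p) then
    -((-1) ^ (⌊(j - k) / (p : ℚ)⌋ - ⌊(i - k) / (p : ℚ)⌋) * (p.choose (i - j).natAbs : ℚ))
  else 0

theorem simpleCrossing_eq_natMatrix (p : ℕ) (k : ℚ) :
    simpleCrossing p (-1 : ℚ) k
      = natMatrix p fun a b => crossingEntry p k ((a : ℤ) + 1) ((b : ℤ) + 1) := by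
  ext a b
  simp [simpleCrossing, natMatrix, crossingEntry, Fin.ext_iff]

theorem crossingEntry_add_one (p : ℕ) (k : ℚ) (i j : ℤ) :
    crossingEntry p (k + 1) (i + 1) (j + 1) = crossingEntry p k i j := by
  have e1 : ((i + 1 : ℤ) : ℚ) - (k + 1) = i - k := by push_cast; ring
  have e2 : ((j + 1 : ℤ) : ℚ) - (k + 1) = j - k := by push_cast; ring
  have e3 : ((i + 1 : ℤ) : ℚ) + (j + 1 : ℤ) - 2 * (k + 1) = i + j - 2 * k := by push_cast; ring
  simp only [crossingEntry, e1, e2, e3, add_left_inj, add_sub_add_right_eq_sub]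

/-- Moving the row number by `p` keeps the congruence and the fractional parts and changes one floor
by one, hence the sign at `ε = -1`; the binomial is unchanged by its symmetry. -/
theorem crossingEntry_zero_left (p : ℕ) (k : ℚ) (j : ℤ) (hj : 1 ≤ j) (hjp : j < p) :
    crossingEntry p k 0 j = -crossingEntry p k p j := by
  have hp : (p : ℚ) ≠ 0 := by
    have : p ≠ 0 := by omega
    exact_mod_cast this
  have e1 : (((p : ℤ) : ℚ) - k) / p = ((0 : ℤ) - k) / p + 1 := by
    field_simp
    push_cast
    ring
  have e2 : (((p : ℤ) : ℚ) + j - 2 * k) / p = ((0 : ℤ) + j - 2 * k) / p + 1 := by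
    field_simp
    push_cast
    ring
  have hc : p.choose ((p : ℤ) - j).natAbs = p.choose (0 - j).natAbs := by
    rw [← Nat.choose_symm (show (0 - j).natAbs ≤ p by omega)]
    congr 1
    omega
  rw [crossingEntry, crossingEntry, if_neg (show ¬ 0 = j by omega),
    if_neg (show ¬ (p : ℤ) = j by omega),
    e1, e2, Int.fract_add_one, Int.fract_add_one, Int.floor_add_one, hc, ← sub_sub,
    zpow_sub_one₀ (by norm_num)]
  split_ifs <;> norm_num

theorem crossingEntry_zero_right (p : ℕ) (k : ℚ) (i : ℤ) (hi : 1 ≤ i) (hip : i < p) :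
    crossingEntry p k i 0 = -crossingEntry p k i p := by
  have hp : (p : ℚ) ≠ 0 := by
    have : p ≠ 0 := by omega
    exact_mod_cast this
  have e1 : (((p : ℤ) : ℚ) - k) / p = ((0 : ℤ) - k) / p + 1 := by
    field_simp
    push_cast
    ring
  have e2 : ((i : ℚ) + (p : ℤ) - 2 * k) / p = (i + (0 : ℤ) - 2 * k) / p + 1 := by
    field_simp
    push_cast
    ring
  have hc : p.choose (i - (p : ℤ)).natAbs = p.choose (i - 0).natAbs := by
    rw [← Nat.choose_symm (show (i - 0).natAbs ≤ p by omega)]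
    congr 1
    omega
  rw [crossingEntry, crossingEntry, if_neg (show ¬ i = 0 by omega),
    if_neg (show ¬ i = (p : ℤ) by omega),
    e1, e2, Int.fract_add_one, Int.fract_add_one, Int.floor_add_one, hc,
    add_sub_right_comm _ (1 : ℤ),
    zpow_add_one₀ (by norm_num)]
  split_ifs <;> norm_num

/-- The entries depend only on the differences of `i`, `j`, `k`. The wrap-around row and column
acquire a sign that matches the sign in the shift. -/
theorem twistedShift_mul_simpleCrossing (p : ℕ) (k : ℚ) :
    twistedShift p * simpleCrossing p (-1 : ℚ) k
      = simpleCrossing p (-1 : ℚ) (k + 1) * twistedShift p := by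
  rw [simpleCrossing_eq_natMatrix, simpleCrossing_eq_natMatrix, twistedShift_mul_natMatrix,
    natMatrix_mul_twistedShift]
  refine natMatrix_congr _ _ _ fun a b ha hb => ?_
  simp only [crossingEntry_add_one]
  have hp : ((p - 1 : ℕ) : ℤ) + 1 = p := by omega
  split_ifs with h1 h2 h2
  · subst h1
    have hb' : (b : ℤ) + 1 = p := by omega
    simp [hp, hb', crossingEntry]
  · subst h1
    rw [hp, Nat.cast_zero, Nat.cast_add_one, crossingEntry_zero_left p k _ (by omega) (by omega)]
  · rw [show ((a - 1 : ℕ) : ℤ) + 1 = a by omega, Nat.cast_zero, show (b : ℤ) + 1 = p by omega,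
      crossingEntry_zero_right p k a (by omega) (by omega), neg_neg]
  · rw [show ((a - 1 : ℕ) : ℤ) + 1 = a by omega, Nat.cast_add_one]

theorem twistedShift_pow_mul_simpleCrossing (p n : ℕ) (k : ℚ) :
    twistedShift p ^ n * simpleCrossing p (-1 : ℚ) k
      = simpleCrossing p (-1 : ℚ) (k + n) * twistedShift p ^ n := by
  induction n with
  | zero => simp
  | succ n ih =>
    rw [pow_succ', mul_assoc, ih, ← mul_assoc, twistedShift_mul_simpleCrossing, mul_assoc,
      Nat.cast_add_one, add_assoc]

/-- The two leftmost factors of the longer product are the initial pair moved by `n`. Pulling `S ^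
n` through them turns `S ^ n T ^ n` into `S ^ n (S T) T ^ n`. -/
theorem multiCrossing_add_two_mul (p n : ℕ) (κ : ℤ) (T : Matrix (Fin p) (Fin p) ℚ)
    (hT : simpleCrossing p (-1 : ℚ) (κ / 2 + 1) * simpleCrossing p (-1 : ℚ) (κ / 2 + 1 / 2)
      = twistedShift p * T) :
    multiCrossing p (-1 : ℚ) (κ + 2 * n) κ = twistedShift p ^ n * T ^ n := by
  rw [multiCrossing, if_pos (by omega), show (κ + 2 * (n : ℤ) - κ).toNat = 2 * n by omega]
  induction n with
  | zero => simp
  | succ n ih =>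
    have e : ∀ m : ℕ, (((κ + 2 * ((n + 1 : ℕ) : ℤ) : ℤ) : ℚ) - (m + 1 + 1 : ℕ)) / 2
        = (((κ + 2 * (n : ℤ) : ℤ) : ℚ) - m) / 2 := by
      intro m
      push_cast
      ring
    have e0 : (((κ + 2 * ((n + 1 : ℕ) : ℤ) : ℤ) : ℚ) - (0 : ℕ)) / 2 = (κ / 2 + 1) + n := by
      push_cast
      ring
    have e1 : (((κ + 2 * ((n + 1 : ℕ) : ℤ) : ℤ) : ℚ) - (0 + 1 : ℕ)) / 2 = (κ / 2 + 1 / 2) + n := by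
      push_cast
      ring
    simp only [show 2 * (n + 1) = 2 * n + 1 + 1 by ring, List.range_succ_eq_map, List.map_cons,
      List.map_map, List.prod_cons, Function.comp_def, Nat.succ_eq_add_one, e, e0, e1]
    rw [ih, ← mul_assoc (simpleCrossing p (-1 : ℚ) (κ / 2 + 1 / 2 + n)),
      ← twistedShift_pow_mul_simpleCrossing, mul_assoc, ← mul_assoc,
      ← twistedShift_pow_mul_simpleCrossing, mul_assoc, ← mul_assoc (simpleCrossing p _ _), hT,
      pow_succ, pow_succ']
    simp only [mul_assoc]

/-! ### Explicit one-step matrices. -/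

/-- The entries on the antidiagonal `a + b + 2 = t` below the diagonal. -/
def antidiagEntry (p t a b : ℕ) : ℚ :=
  if b < a ∧ a + b + 2 = t then (p.choose (a - b) : ℚ) else 0

/-- For `0 < k ≤ 1` every `(i - k) / p` lies in `[0, 1)`: all floors vanish and fractional parts are
ordered as the indices. Off the diagonal, the congruence then admits only `i + j = p + 2k`. -/
theorem crossingEntry_eq_antidiagEntry (p t a b : ℕ) (k : ℚ) (hk : p + 2 * k = t) (hk0 : 0 < k)
    (hk1 : k ≤ 1) (ha : a < p) (hb : b < p) :
    crossingEntry p k ((a : ℤ) + 1) ((b : ℤ) + 1)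
      = (if a = b then 1 else 0) - antidiagEntry p t a b := by
  have hp0 : (0 : ℚ) < p := by exact_mod_cast (by omega : 0 < p)
  have hfloor : ∀ c : ℕ, c < p → ⌊((((c : ℤ) + 1 : ℤ) : ℚ) - k) / p⌋ = 0 := by
    intro c hc
    have hc' : (c : ℚ) + 1 ≤ p := by exact_mod_cast hc
    have hc0 : (0 : ℚ) ≤ c := by positivity
    rw [Int.floor_eq_zero_iff, Set.mem_Ico, div_lt_one hp0]
    push_cast
    exact ⟨div_nonneg (by linarith) hp0.le, by linarith⟩
  have hfract : ∀ c : ℕ, c < p → Int.fract (((((c : ℤ) + 1 : ℤ) : ℚ) - k) / p)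
      = ((((c : ℤ) + 1 : ℤ) : ℚ) - k) / p := by
    intro c hc
    rw [← Int.self_sub_floor, hfloor c hc]
    simp
  have hlt : ((((b : ℤ) + 1 : ℤ) : ℚ) - k) / p < ((((a : ℤ) + 1 : ℤ) : ℚ) - k) / p ↔ b < a := by
    rw [div_lt_div_iff_of_pos_right hp0, sub_lt_sub_iff_right]
    push_cast
    rw [add_lt_add_iff_right]
    exact Nat.cast_lt
  have hmod : a ≠ b → (Int.fract (((((a : ℤ) + 1 : ℤ) : ℚ) + ((b : ℤ) + 1 : ℤ) - 2 * k) / p) = 0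
      ↔ a + b + 2 = t) := by
    intro hab
    have ht : p < t ∧ t ≤ p + 2 := by
      constructor
      · have : (p : ℚ) < t := by linarith
        exact_mod_cast this
      · have : (t : ℚ) ≤ p + 2 := by linarith
        exact_mod_cast this
    have e : ((((a : ℤ) + 1 : ℤ) : ℚ) + ((b : ℤ) + 1 : ℤ) - 2 * k)
        = ((a + b + 2 + p - t : ℤ) : ℚ) := by
      push_cast
      linarith
    rw [Int.fract_eq_zero_iff, e]
    constructor
    · rintro ⟨z, hz⟩
      rw [eq_div_iff hp0.ne'] at hz
      have hz' : z * p = a + b + 2 + p - t := by exact_mod_cast hz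
      have h1 : 0 < z := by
        by_contra! h
        have : z * p ≤ 0 := mul_nonpos_of_nonpos_of_nonneg h (by positivity)
        omega
      have h2 : z < 2 := by
        by_contra! h
        have : 2 * (p : ℤ) ≤ z * p := mul_le_mul_of_nonneg_right h (by positivity)
        omega
      obtain rfl : z = 1 := by omega
      omega
    · intro h
      refine ⟨1, ?_⟩
      rw [eq_div_iff hp0.ne', ← h]
      push_cast
      ring
  simp only [crossingEntry, hfloor a ha, hfloor b hb, hfract a ha, hfract b hb, hlt,
    antidiagEntry]
  by_cases hab : a = b
  · subst hab
    simp
  · simp only [hmod hab]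
    rw [if_neg (by omega), if_neg hab]
    have : (((a : ℤ) + 1) - ((b : ℤ) + 1)).natAbs = a - b ∨ a < b := by omega
    rcases this with h | h
    · rw [h, sub_self, zpow_zero, one_mul, zero_sub]
      split_ifs <;> first | omega | simp
    · rw [if_neg (by omega), if_neg (by omega), sub_zero]

theorem simpleCrossing_eq_one_sub (p t : ℕ) (k : ℚ) (hk : p + 2 * k = t) (hk0 : 0 < k)
    (hk1 : k ≤ 1) :
    simpleCrossing p (-1 : ℚ) k = 1 - natMatrix p (antidiagEntry p t) := by
  rw [simpleCrossing_eq_natMatrix, one_eq_natMatrix, natMatrix_sub]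
  exact natMatrix_congr _ _ _ fun a b ha hb =>
    crossingEntry_eq_antidiagEntry p t a b k hk hk0 hk1 ha hb

/-- The one-step matrix `S⁻¹ M_{k+1} M_{k+1/2}`, where `S` is the twisted shift and
`s = p + 2 k`. -/
def stepMatrix (p s : ℕ) : Matrix (Fin p) (Fin p) ℚ :=
  natMatrix p fun a b => (if b = a + 1 then 1 else 0) - staircaseEntry p s (a + 1) (b + 1)

theorem cast_choose_self (n : ℕ) : (n.choose n : ℚ) = 1 := by simp

theorem stepMatrix_eq (p s : ℕ) : stepMatrix p s = natMatrix p fun a b =>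
    (if b = a + 1 then 1 else 0) - if b ≤ a ∧ (a + b + 2 = s ∨ a + b + 1 = s ∨ (a + 1 = p ∧ b = 0))
      then (p.choose (a + 1 - b) : ℚ) else 0 := by
  refine natMatrix_congr _ _ _ fun a b _ _ => ?_
  rw [staircaseEntry, show a + 1 + 1 - (b + 1) = a + 1 - b by omega]
  congr 1
  exact if_congr (by omega) rfl rfl

/-- A nonzero product would need a middle index `c`, numbered from 0, with `2c < p` and `2c > p -
1`. -/
theorem antidiag_mul_antidiag (p : ℕ) :
    natMatrix p (antidiagEntry p (p + 2)) * natMatrix p (antidiagEntry p (p + 1)) = 0 := by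
  rw [natMatrix_mul]
  ext a b
  simp only [natMatrix, Matrix.of_apply, Matrix.zero_apply]
  refine Finset.sum_eq_zero fun c _ => ?_
  unfold antidiagEntry
  split_ifs <;> first | omega | simp

theorem crossing_mul_crossing_zero (p : ℕ) :
    simpleCrossing p (-1 : ℚ) 1 * simpleCrossing p (-1 : ℚ) (1 / 2)
      = twistedShift p * stepMatrix p p := by
  rw [simpleCrossing_eq_one_sub p (p + 2) 1 (by push_cast; ring) (by norm_num) le_rfl,
    simpleCrossing_eq_one_sub p (p + 1) (1 / 2) (by push_cast; ring) (by norm_num) (by norm_num),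
    sub_mul, one_mul, mul_sub, mul_one, antidiag_mul_antidiag, sub_zero, stepMatrix_eq,
    twistedShift_mul_natMatrix, one_eq_natMatrix, natMatrix_sub, natMatrix_sub]
  refine natMatrix_congr _ _ _ fun a b ha hb => ?_
  rcases a with _ | a
  · rw [show p - 1 + 1 = p by omega]
    rcases b with _ | b
    · simp [antidiagEntry, show 0 ≠ p by omega]
    · simp [antidiagEntry]
      grind
  · simp only [antidiagEntry, Nat.add_sub_cancel]
    grind

/-- This carries the matrices for `s = p` and `s = p + 1` over to `s = p + 2` and `s = p - 1`, so
only two products have to be computed directly. -/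
theorem twistedShift_mul_stepMatrix (p s : ℕ) (hs : s + 1 = p ∨ s = p) :
    twistedShift p * stepMatrix p s = stepMatrix p (s + 2) * twistedShift p := by
  rw [stepMatrix_eq, stepMatrix_eq, twistedShift_mul_natMatrix, natMatrix_mul_twistedShift]
  refine natMatrix_congr _ _ _ fun a b ha hb => ?_
  rcases a with _ | a
  · rw [show p - 1 + 1 = p by omega]
    rcases b with _ | b
    · grind [cast_choose_self]
    · grind [cast_choose_self]
  · rw [show a + 1 + 1 - (b + 1) = a + 1 - b by omega]
    grind [cast_choose_self]

theorem crossing_mul_crossing_one (p : ℕ) :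
    simpleCrossing p (-1 : ℚ) (3 / 2) * simpleCrossing p (-1 : ℚ) 1
      = twistedShift p * stepMatrix p (p + 1) := by
  -- This exhibits `S⁻¹ M_1`: rows move up by one, and the first row of `M_1`, a unit vector,
  -- becomes the last row with a minus sign. Since `M_{3/2} S = S M_{1/2}`, the product becomes `S
  -- M_{1/2} (S⁻¹ M_1)`.
  have hV : simpleCrossing p (-1 : ℚ) 1 = twistedShift p * natMatrix p fun a b =>
      if a + 1 = p then (if b = 0 then -1 else 0)
      else (if a + 1 = b then 1 else 0) - antidiagEntry p (p + 2) (a + 1) b := by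
    rw [simpleCrossing_eq_one_sub p (p + 2) 1 (by push_cast; ring) (by norm_num) le_rfl,
      twistedShift_mul_natMatrix, one_eq_natMatrix, natMatrix_sub]
    refine natMatrix_congr _ _ _ fun a b ha hb => ?_
    rcases a with _ | a
    · rw [show p - 1 + 1 = p by omega]
      simp [antidiagEntry]
      grind [cast_choose_self]
    · simp only [Nat.add_sub_cancel]
      grind [cast_choose_self]
  rw [hV, ← mul_assoc, show (3 / 2 : ℚ) = 1 / 2 + 1 by norm_num,
    ← twistedShift_mul_simpleCrossing, mul_assoc]
  congr 1
  rw [simpleCrossing_eq_one_sub p (p + 1) (1 / 2) (by push_cast; ring) (by norm_num) (by norm_num),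
    sub_mul, one_mul, natMatrix_mul, natMatrix_sub, stepMatrix_eq]
  refine natMatrix_congr _ _ _ fun a b ha hb => ?_
  -- Again the two antidiagonals do not compose, so only the superdiagonal acts, moving columns one
  -- place to the right.
  have hsum : ∑ c ∈ Finset.range p, antidiagEntry p (p + 1) a c * (if c + 1 = p then
      (if b = 0 then -1 else 0)
      else (if c + 1 = b then 1 else 0) - antidiagEntry p (p + 2) (c + 1) b)
      = if b = 0 then 0 else antidiagEntry p (p + 1) a (b - 1) := by
    rcases b with _ | b
    · refine Finset.sum_eq_zero fun c hc => ?_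
      unfold antidiagEntry
      grind [cast_choose_self]
    · rw [Finset.sum_eq_single_of_mem b (Finset.mem_range.2 (by omega))]
      · unfold antidiagEntry
        simp only [Nat.add_sub_cancel]
        grind [cast_choose_self]
      · intro c _ hc
        unfold antidiagEntry
        grind [cast_choose_self]
  rw [hsum]
  rcases b with _ | b
  · simp only [antidiagEntry]
    grind [cast_choose_self]
  · simp only [antidiagEntry, Nat.add_sub_cancel, show a + 1 - (b + 1) = a - b by omega]
    grind [cast_choose_self]

theorem isUnit_twistedShift (p : ℕ) (hp : p ≠ 0) : IsUnit (twistedShift p) := by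
  rw [← isUnit_pow_iff hp, twistedShift_pow_self]
  exact isUnit_one.neg

theorem crossing_mul_crossing_two (p : ℕ) (hp : p ≠ 0) :
    simpleCrossing p (-1 : ℚ) 2 * simpleCrossing p (-1 : ℚ) (3 / 2)
      = twistedShift p * stepMatrix p (p + 2) := by
  refine (isUnit_twistedShift p hp).mul_right_cancel ?_
  rw [mul_assoc, mul_assoc, ← twistedShift_mul_stepMatrix p p (Or.inr rfl),
    ← crossing_mul_crossing_zero, show (3 / 2 : ℚ) = 1 / 2 + 1 by norm_num,
    ← twistedShift_mul_simpleCrossing, show (2 : ℚ) = 1 + 1 by norm_num, ← mul_assoc,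
    ← twistedShift_mul_simpleCrossing, mul_assoc]

theorem crossing_mul_crossing_neg_one (p : ℕ) (hp : p ≠ 0) :
    simpleCrossing p (-1 : ℚ) (1 / 2) * simpleCrossing p (-1 : ℚ) 0
      = twistedShift p * stepMatrix p (p - 1) := by
  refine (isUnit_twistedShift p hp).mul_left_cancel ?_
  rw [twistedShift_mul_stepMatrix p (p - 1) (Or.inl (by omega)), show p - 1 + 2 = p + 1 by omega,
    ← mul_assoc (twistedShift p) (stepMatrix p _), ← crossing_mul_crossing_one, ← mul_assoc,
    twistedShift_mul_simpleCrossing, mul_assoc, twistedShift_mul_simpleCrossing, ← mul_assoc]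
  norm_num

/-! ### Intertwining with the Jordan form, and its characteristic polynomial. -/

/-- The normalising matrix with the entries `normEntry`. -/
def normMatrix (p s : ℕ) : Matrix (Fin p) (Fin p) ℚ :=
  natMatrix p fun a b => normEntry p s (a + 1) (b + 1)

theorem upperJordan_mul_natMatrix (p : ℕ) (f : ℕ → ℕ → ℚ) :
    upperJordan p * natMatrix p f = natMatrix p fun a b => if a + 1 < p then f (a + 1) b else 0 := by
  ext a b
  rw [Matrix.mul_apply]
  simp only [natMatrix, upperJordan, Matrix.of_apply]
  split_ifs with h
  · rw [Finset.sum_eq_single_of_mem (⟨a + 1, h⟩ : Fin p) (Finset.mem_univ _)]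
    · rw [if_pos rfl, one_mul]
    · intro c _ hc
      rw [if_neg, zero_mul]
      intro h2
      exact hc (Fin.ext h2)
  · refine Finset.sum_eq_zero fun c _ => ?_
    have hc := c.2
    rw [if_neg (by omega), zero_mul]

/-- This is the column recurrence in matrix form; the row `p + 1` occurring in it is zero by
convention, in agreement with `J`. -/
theorem normMatrix_mul_stepMatrix (p s : ℕ) (hs : p ≤ s + 1) (hs' : s ≤ p + 2) :
    normMatrix p s * stepMatrix p s = -((1 + upperJordan p) * normMatrix p s) := by
  rw [add_mul, one_mul, normMatrix, upperJordan_mul_natMatrix, natMatrix_add, stepMatrix,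
    natMatrix_mul]
  refine natMatrix_congr p _ (fun a b => -(normEntry p s (a + 1) (b + 1)
    + if a + 1 < p then normEntry p s (a + 1 + 1) (b + 1) else 0)) fun a b ha hb => ?_
  have hrec := normEntry_recurrence p s (a + 1) (b + 1) hs hs' (by omega) ha (by omega) hb
  have hlast : (if a + 1 < p then normEntry p s (a + 1 + 1) (b + 1) else 0)
      = normEntry p s (a + 1 + 1) (b + 1) := by
    split_ifs with h
    · rfl
    · rw [normEntry_of_lt p s _ _ (by omega)]
  have hshift : ∑ c ∈ Finset.range p, normEntry p s (a + 1) (c + 1) * (if b = c + 1 then 1 else 0)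
      = if b + 1 = 1 then 0 else normEntry p s (a + 1) (b + 1 - 1) := by
    rcases b with _ | b
    · exact Finset.sum_eq_zero fun c _ => by rw [if_neg (by omega), mul_zero]
    · rw [Finset.sum_eq_single_of_mem b (Finset.mem_range.2 (by omega))]
      · simp
      · intro c _ hc
        rw [if_neg (by omega), mul_zero]
  have hIcc : ∑ k ∈ Finset.Icc 1 p, normEntry p s (a + 1) k * staircaseEntry p s k (b + 1)
      = ∑ c ∈ Finset.range p, normEntry p s (a + 1) (c + 1) * staircaseEntry p s (c + 1) (b + 1) := by
    rw [← Finset.Ico_add_one_right_eq_Icc, Finset.sum_Ico_eq_sum_range, Nat.add_sub_cancel]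
    simp only [add_comm 1]
  rw [hlast]
  simp only [mul_sub]
  rw [Finset.sum_sub_distrib, hshift, ← hIcc, ← hrec]
  ring

theorem isUnit_det_normMatrix (p s : ℕ) : IsUnit (normMatrix p s).det := by
  rw [Matrix.det_of_isLowerTriangular]
  · rw [isUnit_iff_ne_zero, Finset.prod_ne_zero_iff]
    intro a _
    have : normMatrix p s a a = (-1) ^ ((a : ℕ) + 1) := normEntry_self p s _ a.2
    rw [this]
    exact pow_ne_zero _ (by norm_num)
  · intro a b hab
    exact normEntry_of_lt _ _ _ _ (Or.inl (Nat.succ_lt_succ hab))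

theorem conj_fullTurn_eq_jordanNormalForm (p : ℕ) (hp : 1 ≤ p) (D T M : Matrix (Fin p) (Fin p) ℚ)
    (hD : IsUnit D.det) (hDT : D * T = -((1 + upperJordan p) * D))
    (hM : M = twistedShift p ^ p * T ^ p) :
    D * M * D⁻¹ = jordanNormalForm p := by
  have hpow : ∀ n : ℕ, D * T ^ n = (-1 : ℚ) ^ n • ((1 + upperJordan p) ^ n * D) := by
    intro n
    induction n with
    | zero => simp
    | succ n ih =>
      rw [pow_succ, ← mul_assoc, ih, smul_mul_assoc, mul_assoc, hDT, pow_succ (-1 : ℚ), pow_succ,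
        mul_neg, mul_neg_one, neg_smul, smul_neg, mul_assoc]
  obtain ⟨q, rfl⟩ : ∃ q, p = q + 1 := ⟨p - 1, by omega⟩
  rw [hM, twistedShift_pow_self, neg_one_mul, mul_neg, hpow, jordanNormalForm, Nat.add_sub_cancel,
    ← neg_smul, smul_mul_assoc, Matrix.mul_nonsing_inv_cancel_right _ _ hD, pow_succ (-1 : ℚ)]
  congr 1
  ring

theorem one_add_upperJordan_pow (p n : ℕ) :
    (1 + upperJordan p) ^ n
      = natMatrix p fun a b => if a ≤ b then (n.choose (b - a) : ℚ) else 0 := by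
  induction n with
  | zero =>
    rw [pow_zero, one_eq_natMatrix]
    refine natMatrix_congr _ _ _ fun a b _ _ => ?_
    split_ifs with h1 h2 h2
    · subst h1
      simp
    · omega
    · rw [Nat.choose_eq_zero_of_lt (by omega)]
      simp
    · rfl
  | succ n ih =>
    rw [pow_succ', ih, add_mul, one_mul, upperJordan_mul_natMatrix, natMatrix_add]
    refine natMatrix_congr _ _ _ fun a b _ _ => ?_
    rcases lt_trichotomy a b with h | rfl | h
    · rw [if_pos h.le, if_pos (by omega), if_pos (by omega), if_pos h.le,
        show b - a = b - (a + 1) + 1 by omega, Nat.choose_succ_succ]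
      push_cast
      ring
    · simp
    · split_ifs <;> first | omega | simp

theorem charpoly_jordanNormalForm (p : ℕ) (hp : 1 ≤ p) :
    (jordanNormalForm p).charpoly = (Polynomial.X + Polynomial.C ((-1 : ℚ) ^ p)) ^ p := by
  have hentry : ∀ a b : Fin p, jordanNormalForm p a b
      = (-1) ^ (p - 1) * if (a : ℕ) ≤ b then (p.choose (b - a) : ℚ) else 0 := by
    intro a b
    rw [jordanNormalForm, one_add_upperJordan_pow]
    rfl
  rw [Matrix.charpoly_of_isUpperTriangular]
  · simp only [hentry, le_refl, if_true, Nat.sub_self, Nat.choose_zero_right, Nat.cast_one, mul_one]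
    rw [Finset.prod_const, Finset.card_univ, Fintype.card_fin, sub_eq_add_neg, ← Polynomial.C_neg]
    congr 3
    obtain ⟨q, rfl⟩ : ∃ q, p = q + 1 := ⟨p - 1, by omega⟩
    rw [Nat.add_sub_cancel, pow_succ, mul_neg_one]
  · intro a b hab
    have hab' : (b : ℕ) < a := hab
    rw [hentry, if_neg (by omega), mul_zero]

/-! ### Identification of the given matrices with the common form. -/

open Nat in
theorem factorial_div_eq_choose_pred (i j : ℕ) (hj : 1 ≤ j) (hji : j ≤ i) :
    ((i - 1)! / ((j - 1)! * (i - j)!) : ℚ) = (i - 1).choose (j - 1) := by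
  rw [Nat.cast_choose ℚ (by omega), show i - 1 - (j - 1) = i - j by omega]

open Nat in
theorem factorial_div_eq_choose_sub (p i j : ℕ) (hji : j ≤ i) (hip : i ≤ p) :
    ((p - j)! / ((p - i)! * (i - j)!) : ℚ) = (p - j).choose (i - j) := by
  rw [Nat.cast_choose ℚ (by omega), show p - j - (i - j) = p - i by omega, mul_comm]

-- The parity of `p` reconciles the stated bounds on `2j` with `2j < s` and determines `(-1)^s`. For
-- residue 3 all the stated signs are opposite, which costs only a scalar and does not affect
-- conjugation.
open Nat in
theorem leftEntry_eq (p i j : ℕ) (hj : 1 ≤ j) (hji : j ≤ i) (hip : i ≤ p) :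
    leftEntry p i j = (if p % 4 = 3 then -1 else 1)
      * normEntry p (if p % 4 = 0 ∨ p % 4 = 1 then p + 2 else p + 1) i j := by
  have hA := factorial_div_eq_choose_pred i j hj hji
  have hB := factorial_div_eq_choose_sub p i j hji hip
  have h : p % 4 = 0 ∨ p % 4 = 1 ∨ p % 4 = 2 ∨ p % 4 = 3 := by omega
  unfold leftEntry
  rcases h with h | h | h | h
  · have hs : (-1 : ℚ) ^ (p + 2) = 1 := Even.neg_one_pow (Nat.even_iff.2 (by omega))
    rw [if_pos h, if_neg (show ¬ p % 4 = 3 by omega),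
      if_pos (show p % 4 = 0 ∨ p % 4 = 1 by omega), normEntry,
      if_neg (show ¬ (i < j ∨ p < i) by omega), hA, hB]
    by_cases h1 : 2 * j ≤ p
    · have hδ : ((p + 2 : ℕ) : ℤ) - p - 1 = 1 := by omega
      have hx : (p : ℚ) + j - (p + 2 : ℕ) = j - 2 := by
        push_cast
        ring
      rw [if_pos h1, if_pos (show 2 * j < p + 2 by omega), hδ, hx, pow_add, hs,
        show p + 2 * j - 1 - (p + 2) = 2 * j - 3 by omega,
        show p + 2 - 2 * j = p - 2 * j + 2 by omega]
      by_cases h2 : i + j ≤ p + 2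
      · rw [if_pos h2, if_pos (show i + j ≤ p + 2 by omega)]
        rw [one_mul]
      · rw [if_neg h2, if_neg (show ¬ i + j ≤ p + 2 by omega)]
        ring
    · rw [if_neg h1, if_neg (show ¬ 2 * j < p + 2 by omega)]
      rw [one_mul]
  · have hs : (-1 : ℚ) ^ (p + 2) = -1 := Odd.neg_one_pow (Nat.odd_iff.2 (by omega))
    rw [if_neg (show ¬ p % 4 = 0 by omega), if_pos h, if_neg (show ¬ p % 4 = 3 by omega),
      if_pos (show p % 4 = 0 ∨ p % 4 = 1 by omega), normEntry,
      if_neg (show ¬ (i < j ∨ p < i) by omega), hA, hB]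
    by_cases h1 : 2 * j ≤ p + 1
    · have hδ : ((p + 2 : ℕ) : ℤ) - p - 1 = 1 := by omega
      have hx : (p : ℚ) + j - (p + 2 : ℕ) = j - 2 := by
        push_cast
        ring
      rw [if_pos h1, if_pos (show 2 * j < p + 2 by omega), hδ, hx, pow_add, hs,
        show p + 2 * j - 1 - (p + 2) = 2 * j - 3 by omega]
      by_cases h2 : i + j ≤ p + 2
      · rw [if_pos h2, if_pos (show i + j ≤ p + 2 by omega)]
        rw [one_mul]
      · rw [if_neg h2, if_neg (show ¬ i + j ≤ p + 2 by omega)]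
        ring
    · rw [if_neg h1, if_neg (show ¬ 2 * j < p + 2 by omega)]
      rw [one_mul]
  · have hs : (-1 : ℚ) ^ (p + 1) = -1 := Odd.neg_one_pow (Nat.odd_iff.2 (by omega))
    rw [if_neg (show ¬ p % 4 = 0 by omega), if_neg (show ¬ p % 4 = 1 by omega),
      if_pos h, if_neg (show ¬ p % 4 = 3 by omega),
      if_neg (show ¬ (p % 4 = 0 ∨ p % 4 = 1) by omega), normEntry,
      if_neg (show ¬ (i < j ∨ p < i) by omega), hA, hB]
    by_cases h1 : 2 * j ≤ p
    · have hδ : ((p + 1 : ℕ) : ℤ) - p - 1 = 0 := by omega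
      have hx : (p : ℚ) + j - (p + 1 : ℕ) = j - 1 := by
        push_cast
        ring
      rw [if_pos h1, if_pos (show 2 * j < p + 1 by omega), hδ, hx, pow_add, hs,
        show p + 2 * j - 1 - (p + 1) = 2 * j - 2 by omega,
        show p + 1 - 2 * j = p - 2 * j + 1 by omega]
      by_cases h2 : i + j ≤ p + 1
      · rw [if_pos h2, if_pos (show i + j ≤ p + 1 by omega)]
        rw [one_mul]
      · rw [if_neg h2, if_neg (show ¬ i + j ≤ p + 1 by omega)]
        ring
    · rw [if_neg h1, if_neg (show ¬ 2 * j < p + 1 by omega)]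
      rw [one_mul]
  · have hs : (-1 : ℚ) ^ (p + 1) = 1 := Even.neg_one_pow (Nat.even_iff.2 (by omega))
    rw [if_neg (show ¬ p % 4 = 0 by omega), if_neg (show ¬ p % 4 = 1 by omega),
      if_neg (show ¬ p % 4 = 2 by omega), if_pos h,
      if_neg (show ¬ (p % 4 = 0 ∨ p % 4 = 1) by omega), normEntry,
      if_neg (show ¬ (i < j ∨ p < i) by omega), hA, hB]
    by_cases h1 : 2 * j + 1 ≤ p
    · have hδ : ((p + 1 : ℕ) : ℤ) - p - 1 = 0 := by omega
      have hx : (p : ℚ) + j - (p + 1 : ℕ) = j - 1 := by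
        push_cast
        ring
      rw [if_pos h1, if_pos (show 2 * j < p + 1 by omega), hδ, hx, pow_add, hs,
        show p + 2 * j - 1 - (p + 1) = 2 * j - 2 by omega,
        show p + 1 - 2 * j = p - 2 * j + 1 by omega]
      by_cases h2 : i + j ≤ p + 1
      · rw [if_pos h2, if_pos (show i + j ≤ p + 1 by omega)]
        obtain ⟨l, rfl⟩ : ∃ l, i = l + 1 := ⟨i - 1, by omega⟩
        rw [Nat.add_sub_cancel, pow_succ]
        ring
      · rw [if_neg h2, if_neg (show ¬ i + j ≤ p + 1 by omega)]
        obtain ⟨l, rfl⟩ : ∃ l, j = l + 1 := ⟨j - 1, by omega⟩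
        rw [Nat.add_sub_cancel, pow_succ]
        ring
    · rw [if_neg h1, if_neg (show ¬ 2 * j < p + 1 by omega)]
      have hp : (-1 : ℚ) ^ p = -1 := Odd.neg_one_pow (Nat.odd_iff.2 (by omega))
      have hpj : (-1 : ℚ) ^ (p - j) * (-1) ^ j = -1 := by
        rw [← pow_add, Nat.sub_add_cancel (by omega), hp]
      have hjj : (-1 : ℚ) ^ j * (-1) ^ j = 1 := by rw [← mul_pow]; norm_num
      linear_combination ((p - j).choose (i - j) : ℚ) * ((-1) ^ j * hpj - (-1) ^ (p - j) * hjj)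

open Nat in
theorem rightEntry_eq (p i j : ℕ) (hj : 1 ≤ j) (hji : j ≤ i) (hip : i ≤ p) :
    rightEntry p i j = (if p % 4 = 3 then -1 else 1)
      * normEntry p (if p % 4 = 0 ∨ p % 4 = 1 then p else p - 1) i j := by
  have hA := factorial_div_eq_choose_pred i j hj hji
  have hB := factorial_div_eq_choose_sub p i j hji hip
  have h : p % 4 = 0 ∨ p % 4 = 1 ∨ p % 4 = 2 ∨ p % 4 = 3 := by omega
  unfold rightEntry
  rcases h with h | h | h | h
  · have hs : (-1 : ℚ) ^ p = 1 := Even.neg_one_pow (Nat.even_iff.2 (by omega))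
    rw [if_pos h, if_neg (show ¬ p % 4 = 3 by omega),
      if_pos (show p % 4 = 0 ∨ p % 4 = 1 by omega), normEntry,
      if_neg (show ¬ (i < j ∨ p < i) by omega), hA, hB]
    by_cases h1 : 2 * j + 2 ≤ p
    · have hδ : (p : ℤ) - p - 1 = -1 := by omega
      have hx : (p : ℚ) + j - p = j := by
        ring
      rw [if_pos h1, if_pos (show 2 * j < p by omega), hδ, hx, pow_add, hs,
        show p + 2 * j - 1 - p = 2 * j - 1 by omega]
      by_cases h2 : i + j ≤ p
      · rw [if_pos h2, if_pos (show i + j ≤ p by omega)]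
        rw [one_mul]
      · rw [if_neg h2, if_neg (show ¬ i + j ≤ p by omega)]
        ring
    · rw [if_neg h1, if_neg (show ¬ 2 * j < p by omega)]
      rw [one_mul]
  · have hs : (-1 : ℚ) ^ p = -1 := Odd.neg_one_pow (Nat.odd_iff.2 (by omega))
    rw [if_neg (show ¬ p % 4 = 0 by omega), if_pos h, if_neg (show ¬ p % 4 = 3 by omega),
      if_pos (show p % 4 = 0 ∨ p % 4 = 1 by omega), normEntry,
      if_neg (show ¬ (i < j ∨ p < i) by omega), hA, hB]
    by_cases h1 : 2 * j + 1 ≤ p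
    · have hδ : (p : ℤ) - p - 1 = -1 := by omega
      have hx : (p : ℚ) + j - p = j := by
        ring
      rw [if_pos h1, if_pos (show 2 * j < p by omega), hδ, hx, pow_add, hs,
        show p + 2 * j - 1 - p = 2 * j - 1 by omega]
      by_cases h2 : i + j ≤ p
      · rw [if_pos h2, if_pos (show i + j ≤ p by omega)]
        rw [one_mul]
      · rw [if_neg h2, if_neg (show ¬ i + j ≤ p by omega)]
        ring
    · rw [if_neg h1, if_neg (show ¬ 2 * j < p by omega)]
      rw [one_mul]
  · have hs : (-1 : ℚ) ^ (p - 1) = -1 := Odd.neg_one_pow (Nat.odd_iff.2 (by omega))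
    rw [if_neg (show ¬ p % 4 = 0 by omega), if_neg (show ¬ p % 4 = 1 by omega),
      if_pos h, if_neg (show ¬ p % 4 = 3 by omega),
      if_neg (show ¬ (p % 4 = 0 ∨ p % 4 = 1) by omega), normEntry,
      if_neg (show ¬ (i < j ∨ p < i) by omega), hA, hB]
    by_cases h1 : 2 * j + 2 ≤ p
    · have hδ : ((p - 1 : ℕ) : ℤ) - p - 1 = -2 := by omega
      have hc1 : ((p - 1 : ℕ) : ℚ) = p - 1 := by rw [Nat.cast_sub (by omega), Nat.cast_one]
      have hc2 : ((p - 1 : ℕ) : ℤ) = p - 1 := by omega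
      have hx : (p : ℚ) + j - (p - 1 : ℕ) = j + 1 := by
        rw [hc1]
        ring
      rw [if_pos h1, if_pos (show 2 * j < p - 1 by omega), hδ, hx, pow_add, hs,
        show p + 2 * j - 1 - (p - 1) = 2 * j by omega, show p - 1 - 2 * j = p - 2 * j - 1 by omega]
      by_cases h2 : i + j + 1 ≤ p
      · rw [if_pos h2, if_pos (show i + j ≤ p - 1 by omega)]
        rw [one_mul]
      · rw [if_neg h2, if_neg (show ¬ i + j ≤ p - 1 by omega)]
        ring
    · rw [if_neg h1, if_neg (show ¬ 2 * j < p - 1 by omega)]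
      rw [one_mul]
  · have hs : (-1 : ℚ) ^ (p - 1) = 1 := Even.neg_one_pow (Nat.even_iff.2 (by omega))
    rw [if_neg (show ¬ p % 4 = 0 by omega), if_neg (show ¬ p % 4 = 1 by omega),
      if_neg (show ¬ p % 4 = 2 by omega), if_pos h,
      if_neg (show ¬ (p % 4 = 0 ∨ p % 4 = 1) by omega), normEntry,
      if_neg (show ¬ (i < j ∨ p < i) by omega), hA, hB]
    by_cases h1 : 2 * j + 3 ≤ p
    · have hδ : ((p - 1 : ℕ) : ℤ) - p - 1 = -2 := by omega
      have hc1 : ((p - 1 : ℕ) : ℚ) = p - 1 := by rw [Nat.cast_sub (by omega), Nat.cast_one]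
      have hc2 : ((p - 1 : ℕ) : ℤ) = p - 1 := by omega
      have hx : (p : ℚ) + j - (p - 1 : ℕ) = j + 1 := by
        rw [hc1]
        ring
      rw [if_pos h1, if_pos (show 2 * j < p - 1 by omega), hδ, hx, pow_add, hs,
        show p + 2 * j - 1 - (p - 1) = 2 * j by omega, show p - 1 - 2 * j = p - 2 * j - 1 by omega]
      by_cases h2 : i + j + 1 ≤ p
      · rw [if_pos h2, if_pos (show i + j ≤ p - 1 by omega)]
        obtain ⟨l, rfl⟩ : ∃ l, i = l + 1 := ⟨i - 1, by omega⟩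
        rw [Nat.add_sub_cancel, pow_succ]
        ring
      · rw [if_neg h2, if_neg (show ¬ i + j ≤ p - 1 by omega)]
        obtain ⟨l, rfl⟩ : ∃ l, j = l + 1 := ⟨j - 1, by omega⟩
        rw [Nat.add_sub_cancel, pow_succ]
        ring
    · rw [if_neg h1, if_neg (show ¬ 2 * j < p - 1 by omega)]
      have hp : (-1 : ℚ) ^ p = -1 := Odd.neg_one_pow (Nat.odd_iff.2 (by omega))
      have hpj : (-1 : ℚ) ^ (p - j) * (-1) ^ j = -1 := by
        rw [← pow_add, Nat.sub_add_cancel (by omega), hp]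
      have hjj : (-1 : ℚ) ^ j * (-1) ^ j = 1 := by rw [← mul_pow]; norm_num
      linear_combination ((p - j).choose (i - j) : ℚ) * ((-1) ^ j * hpj - (-1) ^ (p - j) * hjj)

theorem leftNormaliser_eq (p : ℕ) : leftNormaliser p = (if p % 4 = 3 then -1 else 1 : ℚ)
      • normMatrix p (if p % 4 = 0 ∨ p % 4 = 1 then p + 2 else p + 1) := by
  ext a b
  rw [leftNormaliser, Matrix.of_apply, Matrix.smul_apply, smul_eq_mul, normMatrix, natMatrix,
    Matrix.of_apply]
  rcases lt_or_ge a b with h | h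
  · rw [if_pos h, normEntry_of_lt _ _ _ _ (Or.inl (Nat.succ_lt_succ h)), mul_zero]
  · rw [if_neg (not_lt.2 h), leftEntry_eq _ _ _ (by omega) (Nat.succ_le_succ h) a.2]

theorem rightNormaliser_eq (p : ℕ) : rightNormaliser p = (if p % 4 = 3 then -1 else 1 : ℚ)
      • normMatrix p (if p % 4 = 0 ∨ p % 4 = 1 then p else p - 1) := by
  ext a b
  rw [rightNormaliser, Matrix.of_apply, Matrix.smul_apply, smul_eq_mul, normMatrix, natMatrix,
    Matrix.of_apply]
  rcases lt_or_ge a b with h | h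
  · rw [if_pos h, normEntry_of_lt _ _ _ _ (Or.inl (Nat.succ_lt_succ h)), mul_zero]
  · rw [if_neg (not_lt.2 h), rightEntry_eq _ _ _ (by omega) (Nat.succ_le_succ h) a.2]

/-! ### The full-turn identities. -/

theorem conj_smul_normMatrix (p s : ℕ) (hp : 1 ≤ p) (hs : p ≤ s + 1) (hs' : s ≤ p + 2)
    (κ₂ κ : ℤ) (hκ : κ₂ = κ + 2 * p) (c : ℚ) (hc : c ≠ 0)
    (hT : simpleCrossing p (-1 : ℚ) (κ / 2 + 1) * simpleCrossing p (-1 : ℚ) (κ / 2 + 1 / 2)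
      = twistedShift p * stepMatrix p s) :
    (c • normMatrix p s) * multiCrossing p (-1 : ℚ) κ₂ κ * (c • normMatrix p s)⁻¹
      = jordanNormalForm p := by
  subst hκ
  refine conj_fullTurn_eq_jordanNormalForm p hp _ (stepMatrix p s) _ ?_ ?_
    (multiCrossing_add_two_mul p p κ _ hT)
  · rw [Matrix.det_smul]
    exact (hc.isUnit.pow _).mul (isUnit_det_normMatrix p s)
  · rw [smul_mul_assoc, normMatrix_mul_stepMatrix p s hs hs', smul_neg, mul_smul_comm]

theorem mainTheorem11 (p : ℕ) (hp : 1 ≤ p) :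
    (∀ i j : Fin p, i < j → leftNormaliser p i j = 0 ∧ rightNormaliser p i j = 0) ∧
    IsUnit (leftNormaliser p).det ∧
    IsUnit (rightNormaliser p).det ∧
    (p % 4 = 0 ∨ p % 4 = 1 →
      leftNormaliser p * multiCrossing p (-1 : ℚ) (2 * (p + 1)) (2 * 1) * (leftNormaliser p)⁻¹
          = jordanNormalForm p ∧
      rightNormaliser p * multiCrossing p (-1 : ℚ) (2 * p) (2 * 0) * (rightNormaliser p)⁻¹
          = jordanNormalForm p) ∧
    (p % 4 = 2 ∨ p % 4 = 3 →
      leftNormaliser p * multiCrossing p (-1 : ℚ) (2 * p + 1) 1 * (leftNormaliser p)⁻¹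
          = jordanNormalForm p ∧
      rightNormaliser p * multiCrossing p (-1 : ℚ) (2 * p - 1) (-1) * (rightNormaliser p)⁻¹
          = jordanNormalForm p) ∧
    (multiCrossing p (-1 : ℚ) (2 * p) 0).charpoly
      = (Polynomial.X + Polynomial.C ((-1 : ℚ) ^ p)) ^ p := by
  have hp0 : p ≠ 0 := by omega
  have hc : (if p % 4 = 3 then -1 else 1 : ℚ) ≠ 0 := by split_ifs <;> norm_num
  generalize hc' : (if p % 4 = 3 then -1 else 1 : ℚ) = c at hc
  have hdet : ∀ s, IsUnit (c • normMatrix p s).det := by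
    intro s
    rw [Matrix.det_smul]
    exact (hc.isUnit.pow _).mul (isUnit_det_normMatrix p s)
  refine ⟨fun i j hij => ⟨if_pos hij, if_pos hij⟩, ?_, ?_, ?_, ?_, ?_⟩
  · rw [leftNormaliser_eq, hc']
    exact hdet _
  · rw [rightNormaliser_eq, hc']
    exact hdet _
  · intro hr
    rw [leftNormaliser_eq, rightNormaliser_eq, hc', if_pos hr, if_pos hr]
    constructor
    · refine conj_smul_normMatrix p (p + 2) hp (by omega) le_rfl _ _ (by ring) _ hc ?_
      rw [← crossing_mul_crossing_two p hp0]
      norm_num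
    · refine conj_smul_normMatrix p p hp (by omega) (by omega) _ _ (by ring) _ hc ?_
      rw [← crossing_mul_crossing_zero p]
      norm_num
  · intro hr
    rw [leftNormaliser_eq, rightNormaliser_eq, hc', if_neg (show ¬ (p % 4 = 0 ∨ p % 4 = 1) by omega),
      if_neg (show ¬ (p % 4 = 0 ∨ p % 4 = 1) by omega)]
    constructor
    · refine conj_smul_normMatrix p (p + 1) hp (by omega) (by omega) _ _ (by ring) _ hc ?_
      rw [← crossing_mul_crossing_one p]
      norm_num
    · refine conj_smul_normMatrix p (p - 1) hp (by omega) (by omega) _ _ (by ring) _ hc ?_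
      rw [← crossing_mul_crossing_neg_one p hp0]
      norm_num
  -- The choice `s = p` normalises `M_{p,0}` for every residue of `p`, so the characteristic
  -- polynomial needs no case distinction.
  · have h := conj_smul_normMatrix p p hp (by omega) (by omega) (2 * p) 0 (by ring) 1 one_ne_zero (by
      rw [← crossing_mul_crossing_zero p]
      norm_num)
    rw [one_smul] at h
    have hU := isUnit_det_normMatrix p p
    rw [← charpoly_jordanNormalForm p hp, ← h, Matrix.charpoly_mul_comm, ← mul_assoc,
      Matrix.nonsing_inv_mul _ hU, one_mul]
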